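/- Let $\mathbb{H}$ be the quaternions and $\mathbb{S}=\{I\in\mathbb{H}: I^2=-1\}$. For an open set $D\subseteq\mathbb{C}$ that is symmetric with respect to the real axis, put $\Omega=\Omega_D=\{\alpha+I\beta:\alpha,\beta\in\mathbb{R},\ \alpha+i\beta\in D,\ I\in\mathbb{S}\}$ (a circular open set). A function $f:\Omega\to\mathbb{H}$ is called (left slice) regular if there are functions $F_1,F_2:D\to\mathbb{H}$ with $F_1(\bar z)=F_1(z)$ and $F_2(\bar z)=-F_2(z)$ on $D$, such that $F=F_1+F_2\imath:D\to\mathbb{H}\otimes_{\mathbb{R}}\mathbb{C}$ is holomorphic (that is, $F_1,F_2$ are real differentiable with $\partial F_1/\partial\alpha=\partial F_2/\partial\beta$ and $\partial F_1/\partial\beta=-\partial F_2/\partial\alpha$) and $$f(\alpha+I\beta)=F_1(\alpha+i\beta)+I\,F_2(\alpha+i\beta)\qquad\text{for all }\alpha+i\beta\in D,\ I\in\mathbb{S}.$$ **Theorem.** Let $S\subset\mathbb{H}$ be a $3$-dimensional Euclidean sphere (with some center $c\in\mathbb{H}$ and some radius $r>0$), let $p\in\mathbb{H}$ be a point in the interior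 of $S$ (that is, $|p-c|<r$), and let $\Omega=\Omega_D$ be a circular open set, as above, that contains both $S$ and its interior. Then there exists an $\mathbb{H}$-valued (countably additive, Borel) measure $\mu$ on $S$, absolutely continuous with respect to the Euclidean surface measure of $S$, such that every regular function $f$ on $\Omega$ is $\mu$-integrable over $S$ and satisfies $$f(p)=\int_S d\mu(q)\,f(q),$$ where the values of $\mu$ multiply the values of $f$ from the left. -/

import Mathlib

open MeasureTheory Metric
open scoped Quaternion ComplexConjugate

noncomputable section

/-- The quaternions carry their Borel σ-algebra. -/
instance quaternionMeasurableSpace : MeasurableSpace ℍ := borel ℍ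

instance quaternionBorelSpace : BorelSpace ℍ := ⟨rfl⟩

/-- The 2-sphere of imaginary units, `{I ∈ ℍ | I² = -1}`. -/
def imaginaryUnits : Set ℍ := {I | I * I = -1}

/-- The circularization `Ω_D = {α + I β | α + i β ∈ D, I an imaginary unit}` of `D ⊆ ℂ`. -/
def circularization (D : Set ℂ) : Set ℍ :=
  {q | ∃ z ∈ D, ∃ I ∈ imaginaryUnits, q = (z.re : ℍ) + I * (z.im : ℍ)}

/-- `D ⊆ ℂ` is symmetric with respect to the real axis. -/
def IsSymmetricSet (D : Set ℂ) : Prop := ∀ z ∈ D, conj z ∈ D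

/-- `F = F₁ + F₂ ι : D → ℍ ⊗ ℂ` is a stem function: `F (conj z) = F₁ z - F₂ z ι` on `D`. -/
def IsStemFunction (D : Set ℂ) (F₁ F₂ : ℂ → ℍ) : Prop :=
  ∀ z ∈ D, F₁ (conj z) = F₁ z ∧ F₂ (conj z) = -F₂ z

/-- `F = F₁ + F₂ ι : D → ℍ ⊗ ℂ` is holomorphic on the open set `D`: it is real differentiable and
`∂F/∂α + ι ∂F/∂β = 0`, where `z = α + i β` (the Cauchy-Riemann equations, written in the
components of `F`). -/
def IsHolomorphicStem (D : Set ℂ) (F₁ F₂ : ℂ → ℍ) : Prop :=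
  ∀ z ∈ D, DifferentiableAt ℝ F₁ z ∧ DifferentiableAt ℝ F₂ z ∧
    fderiv ℝ F₁ z 1 = fderiv ℝ F₂ z Complex.I ∧
    fderiv ℝ F₁ z Complex.I = -fderiv ℝ F₂ z 1

/-- `f` restricted to `Ω_D` is the (left) slice function induced by `F₁ + F₂ ι`:
`f (α + I β) = F₁ (α + i β) + I F₂ (α + i β)`. -/
def IsInducedBy (D : Set ℂ) (f : ℍ → ℍ) (F₁ F₂ : ℂ → ℍ) : Prop :=
  ∀ z ∈ D, ∀ I ∈ imaginaryUnits, f ((z.re : ℍ) + I * (z.im : ℍ)) = F₁ z + I * F₂ z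

/-- `f` is (left slice) regular on `Ω_D`: it is induced by a holomorphic stem function on `D`.
Only the values of `f` on `Ω_D` matter. -/
def IsSliceRegular (D : Set ℂ) (f : ℍ → ℍ) : Prop :=
  ∃ F₁ F₂ : ℂ → ℍ, IsStemFunction D F₁ F₂ ∧ IsHolomorphicStem D F₁ F₂ ∧ IsInducedBy D f F₁ F₂

/-- The map `u ↦ c + r u` from the unit 3-sphere onto the 3-sphere with center `c` and radius
`r`. -/
def sphereParam (c : ℍ) (r : ℝ) (hr : 0 < r) (u : sphere (0 : ℍ) 1) : sphere c r :=
  ⟨c + r • (u : ℍ), by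
    have hu : ‖(u : ℍ)‖ = 1 := by simp
    simp [norm_smul, hu, abs_of_pos hr]⟩

/-- The Euclidean surface measure on the 3-sphere with center `c` and radius `r`: `r ^ 3` times the
push-forward of the surface measure of the unit sphere. -/
def sphereSurfaceMeasure (c : ℍ) (r : ℝ) (hr : 0 < r) : Measure (sphere c r) :=
  ENNReal.ofReal (r ^ 3) • ((volume : Measure ℍ).toSphere).map (sphereParam c r hr)

/-- The pairing `(x, m) ↦ m * x`, with the value `m` of the measure on the left, through which
quaternionic functions are integrated against quaternionic measures: `∫ dμ(q) f(q)`. -/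
def leftMeasurePairing : ℍ →L[ℝ] ℍ →L[ℝ] ℍ := (ContinuousLinearMap.mul ℝ ℍ).flip

end

/-! Evaluation at `p` is right ℍ-linear on regular functions. Once |f(p)|² ≤ C ∫_S |f|² dσ is known,
a Riesz argument (`exists_density_of_bounded`) represents it by an L² density against the surface
measure σ, and this density times σ is μ. The analytic content is that bound,
`exists_sq_norm_le_integral_sphere`.

Write c = a + bJ with J² = -1, b ≥ 0, and split a unit vector u into its projection v to ℝ + ℝJ ≅ ℂ
and its orthogonal part w. The slice coordinate α + iβ of c + ru depends on v alone (`discParam`).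
Flipping w to -w therefore gives two points of S with the same coordinate and with units I, I' such
that β|I - I'| = 2r√(1 - |v|²). The two values of f determine F₁ and F₂, and integration bounds ∫ (1
- |v|²)² (|F₁|² + |F₂|²) over the unit disc by ∫_S |f|² (`exists_lintegral_disc_le_sphere`).

The real coordinates of F₁ + F₂ι are holomorphic functions g with |g| invariant under conjugation,
so it remains to bound |g(z₀)|² by the weighted disc integral
(`exists_sq_norm_le_of_lintegral_disc_le`). If b = 0, the disc collapses onto the upper half circle
and Cauchy's formula applies. If b > 0, it parametrizes the part of the upper half plane inside the
circle about a + ib and outside the conjugate circle. There the mean value property suffices. The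
other points lie in the disc about a whose boundary passes through the intersections of the two
circles, and the maximum principle reaches them. In both boundary arguments a power of a polynomial
vanishing at two real points absorbs the degeneration of the weight. -/

/-! ### Integration against a vector measure with density -/

section VectorIntegral

open scoped ENNReal

variable {X E F G : Type*} [MeasurableSpace X] [NormedAddCommGroup E] [NormedSpace ℝ E]
  [NormedAddCommGroup F] [NormedSpace ℝ F] [CompleteSpace F]
  [NormedAddCommGroup G] [NormedSpace ℝ G] [CompleteSpace G]

omit [CompleteSpace G] in
lemma lintegral_enorm_bilin_le (σ : Measure X) (h : X → F) (hh : Integrable h σ)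
    (B : E →L[ℝ] F →L[ℝ] G) {f : X → E} (hf : StronglyMeasurable f) :
    ∫⁻ x, ‖B (f x) (h x)‖ₑ ∂σ ≤ ‖B‖ₑ * ∫⁻ x, ‖f x‖ₑ ∂(σ.withDensityᵥ h).variation := by
  -- The variation of the measure with density h is the measure with density |h|.
  rw [Measure.variation_withDensityᵥ hh,
    lintegral_withDensity_eq_lintegral_mul₀ hh.aestronglyMeasurable.enorm
      hf.aestronglyMeasurable.enorm, ← lintegral_const_mul' _ _ (by simp)]
  refine lintegral_mono fun x => ?_
  calc ‖B (f x) (h x)‖ₑ ≤ ‖B (f x)‖ₑ * ‖h x‖ₑ := ContinuousLinearMap.le_opENorm _ _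
    _ ≤ (‖B‖ₑ * ‖f x‖ₑ) * ‖h x‖ₑ := by gcongr; exact ContinuousLinearMap.le_opENorm _ _
    _ = _ := by simp only [Pi.mul_apply]; ring

omit [CompleteSpace G] in
lemma integrable_bilin_of_withDensity (σ : Measure X) (h : X → F) (hh : Integrable h σ)
    (B : E →L[ℝ] F →L[ℝ] G) {f : X → E} (hf : StronglyMeasurable f)
    (hfi : (σ.withDensityᵥ h).Integrable f) : Integrable (fun x => B (f x) (h x)) σ := by
  refine ⟨?_, (lintegral_enorm_bilin_le σ h hh B hf).trans_lt
    (ENNReal.mul_lt_top (by simp) hfi.2)⟩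
  exact B.aestronglyMeasurable_comp₂ hf.aestronglyMeasurable hh.aestronglyMeasurable

/-- The integral against a vector measure with density. -/
theorem integral_withDensityᵥ (σ : Measure X) (h : X → F) (hh : Integrable h σ)
    (B : E →L[ℝ] F →L[ℝ] G) {f : X → E} (hfi : (σ.withDensityᵥ h).Integrable f) :
    VectorMeasure.integral (σ.withDensityᵥ h) f B = ∫ x, B (f x) (h x) ∂σ := by
  have hae : ∀ f g : X → E, f =ᵐ[(σ.withDensityᵥ h).variation] g →
      (fun x => B (f x) (h x)) =ᵐ[σ] fun x => B (g x) (h x) := by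
    intro f g hfg
    rw [Measure.variation_withDensityᵥ hh, Filter.EventuallyEq,
      ae_withDensity_iff' hh.aestronglyMeasurable.enorm] at hfg
    filter_upwards [hfg] with x hx
    -- Equality almost everywhere for the variation says nothing where h = 0, but there both
    -- integrands vanish.
    by_cases h0 : h x = 0
    · simp [h0]
    · rw [hx (by simpa using h0)]
  refine Integrable.induction (μ := (σ.withDensityᵥ h).variation)
    (P := fun f => VectorMeasure.integral (σ.withDensityᵥ h) f B = ∫ x, B (f x) (h x) ∂σ)
    ?_ ?_ ?_ ?_ hfi
  · intro c s hs hfin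
    have h1 : (fun x => B (s.indicator (fun _ => c) x) (h x)) =
        s.indicator (fun x => B c (h x)) := by
      ext x; by_cases hx : x ∈ s <;> simp [hx]
    rw [h1, integral_indicator hs, ContinuousLinearMap.integral_comp_comm _ hh.integrableOn,
      ← withDensityᵥ_apply hh hs]
    rw [VectorMeasure.integral_eq_setToFun, setToFun_indicator_const _ hs hfin.ne]
    rfl
  · intro f g _ hf hg Hf Hg
    have hf' := integrable_bilin_of_withDensity σ h hh B hf.1.stronglyMeasurable_mk
      (hf.congr hf.1.ae_eq_mk)
    have hg' := integrable_bilin_of_withDensity σ h hh B hg.1.stronglyMeasurable_mk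
      (hg.congr hg.1.ae_eq_mk)
    have hf'' := hf'.congr (hae _ _ hf.1.ae_eq_mk).symm
    have hg'' := hg'.congr (hae _ _ hg.1.ae_eq_mk).symm
    rw [VectorMeasure.integral_add hf hg, Hf, Hg, ← integral_add hf'' hg'']
    simp
  -- Both sides are continuous on L¹ of the variation; the right one is Lipschitz with constant ‖B‖.
  · refine isClosed_eq VectorMeasure.continuous_integral ?_
    have : LipschitzWith ‖B‖₊ (fun f : X →₁[(σ.withDensityᵥ h).variation] E =>
        ∫ x, B (f x) (h x) ∂σ) := by
      intro f g
      have hf := integrable_bilin_of_withDensity σ h hh B (Lp.stronglyMeasurable f)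
        (L1.integrable_coeFn f)
      have hg := integrable_bilin_of_withDensity σ h hh B (Lp.stronglyMeasurable g)
        (L1.integrable_coeFn g)
      rw [edist_eq_enorm_sub, ← integral_sub hf hg, Lp.edist_def]
      simp_rw [← _root_.sub_apply, ← map_sub]
      refine (enorm_integral_le_lintegral_enorm _).trans ?_
      rw [eLpNorm_one_eq_lintegral_enorm]
      exact lintegral_enorm_bilin_le σ h hh B
        ((Lp.stronglyMeasurable f).sub (Lp.stronglyMeasurable g))
    exact this.continuous
  · intro f g hfg hf H
    rw [← VectorMeasure.integral_congr_ae hfg, H]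
    exact integral_congr_ae (hae f g hfg)

omit [CompleteSpace F] in
lemma withDensityᵥ_absolutelyContinuous' (σ : Measure X) (h : X → F) (hh : Integrable h σ) :
    VectorMeasure.AbsolutelyContinuous (σ.withDensityᵥ h) σ.toENNRealVectorMeasure := by
  refine VectorMeasure.AbsolutelyContinuous.mk fun i hi₁ hi₂ => ?_
  rw [Measure.toENNRealVectorMeasure_apply_measurable hi₁] at hi₂
  rw [withDensityᵥ_apply hh hi₁, Measure.restrict_zero_set hi₂, integral_zero_measure]

end VectorIntegral

/-- A linear functional on a space of vectors that is bounded by the seminorm `‖T x‖` is represented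
by a vector of the Hilbert space in which `T` takes its values. -/
lemma exists_inner_eq_of_abs_le {V H : Type*} [AddCommGroup V] [Module ℝ V]
    [NormedAddCommGroup H] [InnerProductSpace ℝ H] [CompleteSpace H]
    (T : V →ₗ[ℝ] H) (φ : V →ₗ[ℝ] ℝ) (C : ℝ) (hφ : ∀ x, |φ x| ≤ C * ‖T x‖) :
    ∃ h : H, ∀ x, φ x = inner ℝ h (T x) := by
  -- `T` may have a kernel, so φ is transported to the range through a linear section; Hahn–Banach
  -- then extends it to `H`.
  obtain ⟨s, hs⟩ := T.rangeRestrict.exists_rightInverse_of_surjective T.range_rangeRestrict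
  have hTs : ∀ y : LinearMap.range T, T (s y) = y := fun y =>
    congrArg Subtype.val (LinearMap.congr_fun hs y)
  let ψ : StrongDual ℝ (LinearMap.range T) := (φ ∘ₗ s).mkContinuous C fun y => by
    have := hφ (s y)
    rwa [hTs] at this
  obtain ⟨g, hg, -⟩ := exists_extension_norm_eq (LinearMap.range T) ψ
  refine ⟨(InnerProductSpace.toDual ℝ H).symm g, fun x => ?_⟩
  rw [InnerProductSpace.toDual_symm_apply]
  have h1 := hg ⟨T x, LinearMap.mem_range_self T x⟩
  rw [h1]
  -- The bound forces φ to vanish on the kernel of `T`, so the choice of section is immaterial.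
  have h2 : φ (x - s ⟨T x, LinearMap.mem_range_self T x⟩) = 0 := by
    have := hφ (x - s ⟨T x, LinearMap.mem_range_self T x⟩)
    rw [map_sub T, hTs] at this
    simpa using this
  rw [map_sub, sub_eq_zero] at h2
  exact h2

/-! ### Quaternionic Riesz representation in L² -/

section Duality

variable {X : Type*} [MeasurableSpace X]

/-- A right linear evaluation `f ↦ e f` on a right quaternionic vector space of square integrable
functions that is bounded in the `L²` norm is given by integration against an `L²` density. -/
theorem exists_density_of_bounded {V : Type*} [AddCommGroup V] [Module ℝ V]
    (σ : Measure X)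
    (ι : V →ₗ[ℝ] (X → ℍ)) (hι : ∀ v, MemLp (ι v) 2 σ) (e : V →ₗ[ℝ] ℍ)
    (hmul : ∀ v (l : ℍ), ∃ w, (∀ x, ι w x = ι v x * l) ∧ e w = e v * l)
    (C : ℝ) (hC : ∀ v, ‖e v‖ ^ 2 ≤ C * ∫ x, ‖ι v x‖ ^ 2 ∂σ) :
    ∃ h : X → ℍ, MemLp h 2 σ ∧ ∀ v, e v = ∫ x, h x * ι v x ∂σ := by
  let T : V →ₗ[ℝ] Lp ℍ 2 σ :=
    { toFun := fun v => (hι v).toLp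
      map_add' := fun v w => by
        rw [← MemLp.toLp_add]; congr 1; exact map_add ι v w
      map_smul' := fun a v => by
        rw [RingHom.id_apply, ← MemLp.toLp_const_smul]; congr 1; exact map_smul ι a v }
  have hT : ∀ v, ‖T v‖ ^ 2 = ∫ x, ‖ι v x‖ ^ 2 ∂σ := by
    intro v
    rw [← real_inner_self_eq_norm_sq, L2.inner_def]
    refine integral_congr_ae ?_
    filter_upwards [(hι v).coeFn_toLp] with x hx
    change inner ℝ ((T v : X → ℍ) x) ((T v : X → ℍ) x) = _
    rw [show (T v : X → ℍ) x = ι v x from hx, real_inner_self_eq_norm_sq]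
  let re : ℍ →ₗ[ℝ] ℝ :=
    { toFun := fun q => q.re, map_add' := fun _ _ => rfl, map_smul' := fun _ _ => rfl }
  have hre : ∀ q : ℍ, |q.re| ≤ ‖q‖ := fun q => by
    have h1 : ‖q‖ * ‖q‖ = q.re ^ 2 + q.imI ^ 2 + q.imJ ^ 2 + q.imK ^ 2 := by
      rw [← Quaternion.normSq_eq_norm_mul_self, Quaternion.normSq_def']
    refine abs_le_of_sq_le_sq ?_ (norm_nonneg _)
    nlinarith [sq_nonneg q.imI, sq_nonneg q.imJ, sq_nonneg q.imK]
  -- Only the real part is represented at first: the real inner product of ℍ is Re(h̄ f), so the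
  -- density will be h̄.
  obtain ⟨h, hh⟩ := exists_inner_eq_of_abs_le T (re ∘ₗ e) (Real.sqrt |C|) fun v => by
    refine (hre _).trans (abs_le_of_sq_le_sq' ?_ (by positivity)).2
    rw [mul_pow, Real.sq_sqrt (abs_nonneg _), hT]
    refine (hC v).trans ?_
    gcongr
    exact le_abs_self C
  have hk : MemLp (fun x => star (h x)) 2 σ := by
    refine (Lp.memLp h).of_le ?_ ?_
    · exact continuous_star.comp_aestronglyMeasurable (Lp.aestronglyMeasurable h)
    · filter_upwards with x using by simp
  have hint : ∀ v, Integrable (fun x => star (h x) * ι v x) σ := fun v =>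
    MemLp.integrable_mul hk (hι v)
  have hre2 : ∀ v, (e v).re = (∫ x, star (h x) * ι v x ∂σ).re := by
    intro v
    have h1 := hh v
    rw [L2.inner_def] at h1
    let reL : ℍ →L[ℝ] ℝ := ⟨re, Quaternion.continuous_re⟩
    have h2 : (∫ x, star (h x) * ι v x ∂σ).re = ∫ x, reL (star (h x) * ι v x) ∂σ :=
      (reL.integral_comp_comm (hint v)).symm
    rw [h2]
    refine h1.trans (integral_congr_ae ?_)
    filter_upwards [(hι v).coeFn_toLp] with x hx
    change inner ℝ (h x) ((T v : X → ℍ) x) = (star (h x) * ι v x).re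
    rw [show (T v : X → ℍ) x = ι v x from hx, Quaternion.inner_def]
    simp
  refine ⟨fun x => star (h x), hk, fun v => ?_⟩
  -- Right linearity recovers the other components: applied to v d̄, the identity of real parts says
  -- Re(d d̄) = 0 for the defect d.
  set d := e v - ∫ x, star (h x) * ι v x ∂σ with hd
  obtain ⟨w, hw1, hw2⟩ := hmul v (star d)
  have h3 := hre2 w
  have h4 : ∫ x, star (h x) * ι w x ∂σ = (∫ x, star (h x) * ι v x ∂σ) * star d := by
    simp_rw [hw1, ← mul_assoc]
    exact integral_mul_const_of_integrable (hint v)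
  rw [hw2, h4, ← sub_eq_zero, ← Quaternion.re_sub, ← sub_mul, ← hd] at h3
  have h5 : ‖d‖ * ‖d‖ = 0 := by
    rw [← Quaternion.normSq_eq_norm_mul_self, ← h3]
    simp [Quaternion.normSq_def]
  exact sub_eq_zero.1 (norm_eq_zero.1 (mul_self_eq_zero.1 h5))

end Duality

/-! ### Surface measure of the unit sphere and volumes of cones -/

section Cone

open scoped ENNReal Pointwise

variable {E : Type*} [NormedAddCommGroup E] [NormedSpace ℝ E] [MeasurableSpace E] [BorelSpace E]
  [FiniteDimensional ℝ E]

/-- `toSphere` gives a set the dimension times the volume of the cone over it. The left side is at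
most that volume, and the dimension is at least 1. -/
lemma map_restrict_normalize_le_toSphere [Nontrivial E] (μ : Measure E) [μ.IsAddHaarMeasure] :
    (μ.restrict (ball 0 1 \ {0})).map (fun x => ‖x‖⁻¹ • x) ≤
      μ.toSphere.map (Subtype.val : sphere (0 : E) 1 → E) := by
  have hm : Measurable fun x : E => ‖x‖⁻¹ • x := measurable_norm.inv.smul measurable_id
  refine Measure.le_iff.2 fun s hs => ?_
  rw [Measure.map_apply hm hs, Measure.map_apply measurable_subtype_coe hs,
    Measure.restrict_apply (hm hs), Measure.toSphere_apply' _ (measurable_subtype_coe hs)]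
  have h1 : (1 : ℝ≥0∞) ≤ (Module.finrank ℝ E : ℝ≥0∞) := by
    exact_mod_cast Module.finrank_pos
  refine le_trans (measure_mono ?_) (le_mul_of_one_le_left (zero_le) h1)
  rintro x ⟨hx, hx1, hx0⟩
  have hx0' : ‖x‖ ≠ 0 := by simpa using hx0
  refine ⟨‖x‖, ⟨by positivity, by simpa using hx1⟩, ‖x‖⁻¹ • x,
    ⟨⟨‖x‖⁻¹ • x, by simp [norm_smul, hx0']⟩, hx, rfl⟩, ?_⟩
  simp [smul_smul, hx0']

lemma lintegral_normalize_le_toSphere [Nontrivial E] (μ : Measure E) [μ.IsAddHaarMeasure]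
    {h : E → ℝ≥0∞} (hh : Measurable h) :
    ∫⁻ x in ball 0 1 \ {0}, h (‖x‖⁻¹ • x) ∂μ ≤ ∫⁻ u : sphere (0 : E) 1, h u ∂μ.toSphere := by
  have hm : Measurable fun x : E => ‖x‖⁻¹ • x := measurable_norm.inv.smul measurable_id
  rw [← lintegral_map hh hm, ← lintegral_map hh measurable_subtype_coe]
  exact lintegral_mono' (map_restrict_normalize_le_toSphere μ) le_rfl

end Cone

/-! ### Projection of the 3-sphere to a disc -/

section Archimedes

open scoped ENNReal

/-- The Euclidean norm on `ℂ × ℂ`. -/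
noncomputable def pairNorm (x : ℂ × ℂ) : ℝ := Real.sqrt (‖x.1‖ ^ 2 + ‖x.2‖ ^ 2)

lemma pairNorm_sq (x : ℂ × ℂ) : pairNorm x ^ 2 = ‖x.1‖ ^ 2 + ‖x.2‖ ^ 2 :=
  Real.sq_sqrt (by positivity)

lemma pairNorm_nonneg (x : ℂ × ℂ) : 0 ≤ pairNorm x := Real.sqrt_nonneg _

lemma continuous_pairNorm : Continuous pairNorm := by
  unfold pairNorm; fun_prop

/-- A spherical shell in `ℂ × ℂ`. -/
def shell : Set (ℂ × ℂ) := {x | 1 / 2 < pairNorm x ∧ pairNorm x < 1}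

lemma isOpen_shell : IsOpen shell :=
  (isOpen_lt continuous_const continuous_pairNorm).inter
    (isOpen_lt continuous_pairNorm continuous_const)

/-- The map `(z, w) ↦ (z / |(z, w)|, w)`. -/
noncomputable def normalizeFst (x : ℂ × ℂ) : ℂ × ℂ := ((pairNorm x)⁻¹ • x.1, x.2)

lemma contDiffAt_normalizeFst {x : ℂ × ℂ} (hx : pairNorm x ≠ 0) :
    ContDiffAt ℝ 1 normalizeFst x := by
  have h0 : ‖x.1‖ ^ 2 + ‖x.2‖ ^ 2 ≠ 0 := by
    rw [← pairNorm_sq]; positivity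
  have h1 : ContDiffAt ℝ 1 (fun x : ℂ × ℂ => ‖x.1‖ ^ 2 + ‖x.2‖ ^ 2) x :=
    (contDiffAt_fst.norm_sq ℝ).add (contDiffAt_snd.norm_sq ℝ)
  have h2 : ContDiffAt ℝ 1 pairNorm x := h1.sqrt h0
  exact ((h2.inv hx).smul contDiffAt_fst).prodMk contDiffAt_snd

instance isAddHaarMeasure_volume_complex_prod : (volume : Measure (ℂ × ℂ)).IsAddHaarMeasure := by
  rw [Measure.volume_eq_prod]; infer_instance

/-- The closed shell is compact and avoids the origin, so the Jacobian of `normalizeFst` is bounded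
on it. -/
lemma exists_measure_image_normalizeFst_le :
    ∃ M : ℝ, 0 < M ∧ ∀ s ⊆ shell, MeasurableSet s →
      volume (normalizeFst '' s) ≤ ENNReal.ofReal M * volume s := by
  let K : Set (ℂ × ℂ) := {x | 1 / 2 ≤ pairNorm x ∧ pairNorm x ≤ 1}
  have hKc : IsClosed K := (isClosed_le continuous_const continuous_pairNorm).inter
    (isClosed_le continuous_pairNorm continuous_const)
  have hK : IsCompact K := by
    refine (isCompact_closedBall (0 : ℂ × ℂ) 1).of_isClosed_subset hKc fun x hx => ?_
    have h1 := pairNorm_sq x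
    have h2 := hx.2
    have h3 := pairNorm_nonneg x
    rw [mem_closedBall_zero_iff, Prod.norm_def, sup_le_iff]
    constructor <;>
    · refine (sq_le_one_iff₀ (norm_nonneg _)).1 ?_
      nlinarith [sq_nonneg ‖x.1‖, sq_nonneg ‖x.2‖]
  have hsub : ∀ x ∈ K, pairNorm x ≠ 0 := fun x hx => by have := hx.1; positivity
  have hcont : ContinuousOn (fun x => |(fderiv ℝ normalizeFst x).det|) K := by
    intro x hx
    have h1 := (contDiffAt_normalizeFst (hsub x hx)).continuousAt_fderiv (by norm_num)
    have h2 : ContinuousAt (fun A : (ℂ × ℂ) →L[ℝ] (ℂ × ℂ) => A.det) (fderiv ℝ normalizeFst x) :=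
      ContinuousLinearMap.continuous_det.continuousAt
    exact (ContinuousAt.comp (f := fderiv ℝ normalizeFst) h2 h1).abs.continuousWithinAt
  obtain ⟨M, hM⟩ := hK.exists_bound_of_continuousOn hcont
  refine ⟨max M 1, by positivity, fun s hs hsm => ?_⟩
  have hsK : s ⊆ K := fun x hx => ⟨(hs hx).1.le, (hs hx).2.le⟩
  refine (addHaar_image_le_lintegral_abs_det_fderiv volume hsm
    (f' := fderiv ℝ normalizeFst) fun x hx => ?_).trans ?_
  · exact ((contDiffAt_normalizeFst (hsub x (hsK hx))).differentiableAt
      (by norm_num)).hasFDerivAt.hasFDerivWithinAt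
  · rw [← setLIntegral_const]
    refine setLIntegral_mono measurable_const fun x hx => ?_
    refine ENNReal.ofReal_le_ofReal (le_trans ?_ (le_max_left _ _))
    simpa using hM x (hsK hx)

/-- With R = √(1 - |v|²), the point (tv, w) with t = |w|/R has norm t and maps to (v, w); it lies in
the shell when R/2 < |w| < R. The ball of center 3R/4 and radius R/4 sits inside this annulus. -/
lemma ball_subset_normalizeFst_image {s : Set ℂ} {v w : ℂ} (hv : ‖v‖ < 1) (hvs : v ∈ s)
    (hw : w ∈ ball ((3 / 4 * Real.sqrt (1 - ‖v‖ ^ 2) : ℝ) : ℂ) (1 / 4 * Real.sqrt (1 - ‖v‖ ^ 2))) :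
    (v, w) ∈ normalizeFst '' (shell ∩ {x | (pairNorm x)⁻¹ • x.1 ∈ s}) := by
  set R := Real.sqrt (1 - ‖v‖ ^ 2) with hR
  have hpos : 0 < 1 - ‖v‖ ^ 2 := by nlinarith [norm_nonneg v]
  have hR0 : 0 < R := Real.sqrt_pos.2 hpos
  have hR2 : R ^ 2 = 1 - ‖v‖ ^ 2 := Real.sq_sqrt hpos.le
  rw [mem_ball, dist_eq_norm] at hw
  have hn : ‖((3 / 4 * R : ℝ) : ℂ)‖ = 3 / 4 * R := by
    rw [Complex.norm_real, Real.norm_of_nonneg (by positivity)]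
  have h1 : 1 / 2 * R < ‖w‖ := by
    have := norm_sub_norm_le ((3 / 4 * R : ℝ) : ℂ) w
    rw [norm_sub_rev, hn] at this
    linarith
  have h2 : ‖w‖ < R := by
    have := norm_sub_norm_le w ((3 / 4 * R : ℝ) : ℂ)
    rw [hn] at this
    linarith
  have ht : pairNorm ((‖w‖ / R) • v, w) = ‖w‖ / R := by
    rw [pairNorm, norm_smul, Real.norm_of_nonneg (by positivity)]
    rw [show (‖w‖ / R * ‖v‖) ^ 2 + ‖w‖ ^ 2 = (‖w‖ / R) ^ 2 by
      field_simp; rw [hR2]; ring]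
    exact Real.sqrt_sq (by positivity)
  have hw0 : 0 < ‖w‖ := by linarith
  have hsm : (‖w‖ / R)⁻¹ • (‖w‖ / R) • v = v := inv_smul_smul₀ (by positivity) v
  refine ⟨((‖w‖ / R) • v, w), ⟨⟨?_, ?_⟩, ?_⟩, ?_⟩
  · rw [ht, lt_div_iff₀ hR0]; exact h1
  · rw [ht, div_lt_one hR0]; exact h2
  · simp only [Set.mem_ofPred_eq]
    rw [ht, hsm]; exact hvs
  · simp only [normalizeFst]
    rw [ht, hsm]

/-- The disc measure with density `1 - |v|²` is dominated by the image of the Lebesgue measure of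
the shell under `(z, w) ↦ z / |(z, w)|`. -/
lemma exists_lintegral_disc_le_shell :
    ∃ M : ℝ, 0 < M ∧ ∀ g : ℂ → ℝ≥0∞, Measurable g →
      ∫⁻ v in ball 0 1, ENNReal.ofReal (1 - ‖v‖ ^ 2) * g v ≤
        ENNReal.ofReal M * ∫⁻ x in shell, g ((pairNorm x)⁻¹ • x.1) := by
  obtain ⟨M, hM, hMs⟩ := exists_measure_image_normalizeFst_le
  refine ⟨16 / Real.pi * M, by positivity, fun g hg => ?_⟩
  have hmeas : Measurable fun x : ℂ × ℂ => (pairNorm x)⁻¹ • x.1 :=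
    continuous_pairNorm.measurable.inv.smul measurable_fst
  have hd : Measurable fun v : ℂ => ENNReal.ofReal (1 - ‖v‖ ^ 2) := by fun_prop
  have key : ((volume.restrict (ball (0 : ℂ) 1)).withDensity
      fun v => ENNReal.ofReal (1 - ‖v‖ ^ 2)) ≤
      ENNReal.ofReal (16 / Real.pi * M) •
        (volume.restrict shell).map (fun x : ℂ × ℂ => (pairNorm x)⁻¹ • x.1) := by
    refine Measure.le_iff.2 fun s hs => ?_
    rw [Measure.smul_apply, smul_eq_mul, Measure.map_apply hmeas hs,
      Measure.restrict_apply (hmeas hs), withDensity_apply _ hs, Measure.restrict_restrict hs]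
    set t := shell ∩ {x | (pairNorm x)⁻¹ • x.1 ∈ s} with ht
    have htm : MeasurableSet t := isOpen_shell.measurableSet.inter (hmeas hs)
    have himg := hMs t Set.inter_subset_left htm
    let U : Set (ℂ × ℂ) := {x | x.1 ∈ s ∩ ball 0 1 ∧
      x.2 ∈ ball ((3 / 4 * Real.sqrt (1 - ‖x.1‖ ^ 2) : ℝ) : ℂ) (1 / 4 * Real.sqrt (1 - ‖x.1‖ ^ 2))}
    have hU : MeasurableSet U := by
      refine (measurable_fst (hs.inter measurableSet_ball)).inter ?_
      refine (isOpen_lt (f := fun x : ℂ × ℂ => dist x.2 ((3 / 4 * Real.sqrt (1 - ‖x.1‖ ^ 2) : ℝ) : ℂ))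
        (g := fun x : ℂ × ℂ => 1 / 4 * Real.sqrt (1 - ‖x.1‖ ^ 2)) ?_ ?_).measurableSet
      · fun_prop
      · fun_prop
    have hUt : U ⊆ normalizeFst '' t := by
      rintro ⟨v, w⟩ ⟨⟨h1, h2⟩, h3⟩
      exact ball_subset_normalizeFst_image (by simpa using h2) h1 h3
    -- By Fubini: the fibre of `U` over v is a disc of area (π/16)(1 - |v|²), which is the origin of
    -- the density.
    have hUvol : volume U = ∫⁻ v in s ∩ ball 0 1,
        ENNReal.ofReal (Real.pi / 16) * ENNReal.ofReal (1 - ‖v‖ ^ 2) := by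
      rw [Measure.volume_eq_prod, Measure.prod_apply hU,
        ← lintegral_indicator (hs.inter measurableSet_ball)]
      refine lintegral_congr fun v => ?_
      by_cases hv : v ∈ s ∩ ball 0 1
      · rw [Set.indicator_of_mem hv]
        have : Prod.mk v ⁻¹' U = ball ((3 / 4 * Real.sqrt (1 - ‖v‖ ^ 2) : ℝ) : ℂ)
            (1 / 4 * Real.sqrt (1 - ‖v‖ ^ 2)) := by
          ext w; simp only [U, Set.mem_preimage, Set.mem_ofPred_eq, hv, true_and]
        have hv1 : ‖v‖ < 1 := by simpa using hv.2
        have hpos : 0 ≤ 1 - ‖v‖ ^ 2 := by nlinarith [norm_nonneg v]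
        rw [this, Complex.volume_ball, ← ENNReal.ofReal_pow (by positivity),
          show (NNReal.pi : ℝ≥0∞) = ENNReal.ofReal Real.pi from
            (ENNReal.ofReal_eq_coe_nnreal Real.pi_pos.le).symm,
          ← ENNReal.ofReal_mul (by positivity), ← ENNReal.ofReal_mul (by positivity), mul_pow,
          Real.sq_sqrt hpos]
        congr 1; ring
      · rw [Set.indicator_of_notMem hv]
        have : Prod.mk v ⁻¹' U = ∅ := by
          ext w; simp only [U, Set.mem_preimage, Set.mem_ofPred_eq, hv, false_and,
            Set.mem_empty_iff_false]
        rw [this, measure_empty]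
    rw [lintegral_const_mul _ hd] at hUvol
    calc ∫⁻ v in s ∩ ball 0 1, ENNReal.ofReal (1 - ‖v‖ ^ 2)
        = ENNReal.ofReal (16 / Real.pi) * volume U := by
          rw [hUvol, ← mul_assoc, ← ENNReal.ofReal_mul (by positivity),
            show 16 / Real.pi * (Real.pi / 16) = 1 by field_simp, ENNReal.ofReal_one, one_mul]
      _ ≤ ENNReal.ofReal (16 / Real.pi) * (ENNReal.ofReal M * volume t) := by
          gcongr
          exact (measure_mono hUt).trans himg
      _ = _ := by
          rw [← mul_assoc, ← ENNReal.ofReal_mul (by positivity), Set.inter_comm]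
          rfl
  have h1 := lintegral_mono' key (le_refl g)
  rw [lintegral_withDensity_eq_lintegral_mul _ hd hg, lintegral_smul_measure,
    lintegral_map hg hmeas] at h1
  exact h1

end Archimedes

/-! ### Orthonormal quaternionic frames adapted to an imaginary unit -/

section Frame

lemma re_eq_zero_of_mul_self {J : ℍ} (hJ : J * J = -1) : J.re = 0 := by
  have h0 := congrArg QuaternionAlgebra.re hJ
  have h1 := congrArg QuaternionAlgebra.imI hJ
  have h2 := congrArg QuaternionAlgebra.imJ hJ
  have h3 := congrArg QuaternionAlgebra.imK hJ
  simp at h0 h1 h2 h3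
  by_contra h
  have e1 : J.imI = 0 := by
    have : J.re * J.imI = 0 := by linarith
    simpa [h] using this
  have e2 : J.imJ = 0 := by
    have : J.re * J.imJ = 0 := by linarith
    simpa [h] using this
  have e3 : J.imK = 0 := by
    have : J.re * J.imK = 0 := by linarith
    simpa [h] using this
  rw [e1, e2, e3] at h0
  nlinarith [sq_nonneg J.re]

lemma norm_eq_one_of_mul_self {J : ℍ} (hJ : J * J = -1) : ‖J‖ = 1 := by
  have h := congrArg norm hJ
  rw [norm_mul, norm_neg, norm_one] at h
  nlinarith [norm_nonneg J]

lemma im_eq_self_of_mul_self {J : ℍ} (hJ : J * J = -1) : J.im = J := by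
  ext <;> simp [re_eq_zero_of_mul_self hJ]

lemma norm_sq_eq_re_im (q : ℍ) : ‖q‖ ^ 2 = q.re ^ 2 + ‖q.im‖ ^ 2 := by
  rw [sq ‖q‖, sq ‖q.im‖, ← Quaternion.normSq_eq_norm_mul_self, ← Quaternion.normSq_eq_norm_mul_self,
    Quaternion.normSq_def', Quaternion.normSq_def']
  simp
  ring

/-- A commutator Jx - xJ is purely imaginary and anticommutes with J. It is nonzero for x = i or x =
j, since otherwise J would be real; normalizing it gives K. -/
lemma exists_anticommuting_unit {J : ℍ} (hJ : J * J = -1) :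
    ∃ K : ℍ, K * K = -1 ∧ K * J = -(J * K) := by
  have hre := re_eq_zero_of_mul_self hJ
  obtain ⟨x, hx⟩ : ∃ x : ℍ, J * x - x * J ≠ 0 := by
    by_contra! hcon
    obtain ⟨i, hi₀, hi₁, hi₂, hi₃⟩ : ∃ i : ℍ, i.re = 0 ∧ i.imI = 1 ∧ i.imJ = 0 ∧ i.imK = 0 :=
      ⟨⟨0, 1, 0, 0⟩, rfl, rfl, rfl, rfl⟩
    obtain ⟨j, hj₀, hj₁, hj₂, hj₃⟩ : ∃ j : ℍ, j.re = 0 ∧ j.imI = 0 ∧ j.imJ = 1 ∧ j.imK = 0 :=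
      ⟨⟨0, 0, 1, 0⟩, rfl, rfl, rfl, rfl⟩
    have h1 := hcon i
    have h2 := hcon j
    have a1 := congrArg QuaternionAlgebra.imJ h1
    have a2 := congrArg QuaternionAlgebra.imK h1
    have a3 := congrArg QuaternionAlgebra.imK h2
    simp [hi₀, hi₁, hi₂, hi₃] at a1 a2
    simp [hj₀, hj₁, hj₂, hj₃] at a3
    have h0 := congrArg QuaternionAlgebra.re hJ
    simp at h0
    have e1 : J.imI = 0 := by linarith
    have e2 : J.imJ = 0 := by linarith
    have e3 : J.imK = 0 := by linarith
    rw [hre, e1, e2, e3] at h0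
    norm_num at h0
  set L := J * x - x * J with hL
  have hLre : L.re = 0 := by
    rw [hL]; simp; ring
  have hLL : L * L = -((‖L‖ ^ 2 : ℝ) : ℍ) := by
    have h1 : L.im = L := by ext <;> simp [hLre]
    have h2 := Quaternion.im_sq L
    rw [h1, sq, Quaternion.normSq_eq_norm_mul_self] at h2
    rw [h2, sq]
  have hanti : L * J = -(J * L) := by
    have h1 : J * (J * x) = -x := by rw [← mul_assoc, hJ]; simp
    have h2 : x * J * J = -x := by rw [mul_assoc, hJ]; simp
    rw [hL, sub_mul, mul_sub, h1, h2, mul_assoc]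
    abel
  have hn : ‖L‖ ≠ 0 := by simpa using hx
  refine ⟨‖L‖⁻¹ • L, ?_, ?_⟩
  · rw [smul_mul_smul_comm, hLL, smul_neg, ← Quaternion.coe_smul]
    congr 1
    rw [smul_eq_mul, show ‖L‖⁻¹ * ‖L‖⁻¹ * ‖L‖ ^ 2 = 1 by field_simp]
    rfl
  · rw [smul_mul_assoc, hanti, mul_smul_comm, smul_neg]

/-- Real linear coordinates on `ℍ` adapted to the imaginary unit `J`. -/
lemma exists_frame {J : ℍ} (hJ : J * J = -1) :
    ∃ T : (ℂ × ℂ) ≃L[ℝ] ℍ, (∀ x, (T x).re = x.1.re) ∧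
      ∀ x (b : ℝ), ‖(T x).im + b • J‖ ^ 2 = (x.1.im + b) ^ 2 + ‖x.2‖ ^ 2 := by
  obtain ⟨K, hK, hKJ⟩ := exists_anticommuting_unit hJ
  have hJK : (J * K) * (J * K) = -1 := by
    rw [mul_assoc, ← mul_assoc K, hKJ, neg_mul, mul_assoc, hK]
    simp [hJ]
  let T₀ : (ℂ × ℂ) →ₗ[ℝ] ℍ :=
    { toFun := fun x => (x.1.re : ℍ) + x.1.im • J + x.2.re • K + x.2.im • (J * K)
      map_add' := fun x y => by
        simp [add_smul]; abel
      map_smul' := fun t x => by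
        simp [smul_smul, Quaternion.coe_mul_eq_smul] }
  have hre : ∀ x, (T₀ x).re = x.1.re := fun x => by
    have h1 := re_eq_zero_of_mul_self hJ
    have h2 := re_eq_zero_of_mul_self hK
    have h3 := re_eq_zero_of_mul_self hJK
    change ((x.1.re : ℍ) + x.1.im • J + x.2.re • K + x.2.im • (J * K)).re = _
    rw [Quaternion.re_add, Quaternion.re_add, Quaternion.re_add, Quaternion.re_smul,
      Quaternion.re_smul, Quaternion.re_smul, h1, h2, h3]
    simp
  have him : ∀ x, (T₀ x).im = x.1.im • J + x.2.re • K + x.2.im • (J * K) := fun x => by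
    have h1 := Quaternion.re_add_im (T₀ x)
    rw [hre] at h1
    have h2 : T₀ x = (x.1.re : ℍ) + (x.1.im • J + x.2.re • K + x.2.im • (J * K)) := by
      change (x.1.re : ℍ) + x.1.im • J + x.2.re • K + x.2.im • (J * K) = _
      abel
    rw [h2] at h1 ⊢
    exact add_left_cancel h1
  -- J, K, JK anticommute pairwise, so the cross terms of the square cancel and its norm can be read
  -- off.
  have hnorm : ∀ p q s : ℝ, ‖p • J + q • K + s • (J * K)‖ ^ 2 = p ^ 2 + q ^ 2 + s ^ 2 := by
    intro p q s
    have h1 : (p • J + q • K + s • (J * K)) * (p • J + q • K + s • (J * K)) =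
        -((p ^ 2 + q ^ 2 + s ^ 2 : ℝ) : ℍ) := by
      have e1 : J * (J * K) = -K := by rw [← mul_assoc, hJ]; simp
      have e2 : J * K * J = K := by rw [mul_assoc, hKJ, mul_neg, e1, neg_neg]
      have e3 : K * (J * K) = J := by rw [← mul_assoc, hKJ, neg_mul, mul_assoc, hK]; simp
      have e4 : J * K * K = -J := by rw [mul_assoc, hK]; simp
      simp only [mul_add, add_mul, smul_mul_smul_comm, hJ, hK, hJK, hKJ, e1, e2, e3, e4, smul_neg]
      have : ((p ^ 2 + q ^ 2 + s ^ 2 : ℝ) : ℍ) =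
          (p * p) • (1 : ℍ) + (q * q) • (1 : ℍ) + (s * s) • (1 : ℍ) := by
        rw [← add_smul, ← add_smul, ← Quaternion.coe_mul_eq_smul, mul_one]
        congr 1; ring
      rw [this, mul_comm q p, mul_comm s p, mul_comm s q]
      abel
    rw [sq, ← norm_mul, h1, norm_neg, Quaternion.norm_coe, Real.norm_of_nonneg (by positivity)]
  have hnormT : ∀ x (b : ℝ), ‖(T₀ x).im + b • J‖ ^ 2 = (x.1.im + b) ^ 2 + ‖x.2‖ ^ 2 := by
    intro x b
    rw [him, show x.1.im • J + x.2.re • K + x.2.im • (J * K) + b • J =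
      (x.1.im + b) • J + x.2.re • K + x.2.im • (J * K) by rw [add_smul]; abel, hnorm,
      ← Complex.normSq_eq_norm_sq, Complex.normSq_apply]
    ring
  have hinj : Function.Injective T₀ := by
    rw [← LinearMap.ker_eq_bot, LinearMap.ker_eq_bot']
    intro x hx
    have h1 := hre x
    have h2 := hnormT x 0
    rw [hx] at h1 h2
    simp at h1 h2
    have h3 : x.1.im = 0 := by nlinarith [sq_nonneg x.1.im, sq_nonneg ‖x.2‖]
    have h4 : ‖x.2‖ = 0 := by nlinarith [sq_nonneg x.1.im, sq_nonneg ‖x.2‖]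
    refine Prod.ext (Complex.ext h1.symm h3) (norm_eq_zero.1 h4)
  have hfin : Module.finrank ℝ (ℂ × ℂ) = Module.finrank ℝ ℍ := by
    rw [Module.finrank_prod, Complex.finrank_real_complex, Quaternion.finrank_eq_four]
  let Te := (T₀.linearEquivOfInjective hinj hfin).toContinuousLinearEquiv
  exact ⟨Te, hre, hnormT⟩

lemma norm_frame {J : ℍ} {T : (ℂ × ℂ) ≃L[ℝ] ℍ} (hre : ∀ x, (T x).re = x.1.re)
    (him : ∀ x (b : ℝ), ‖(T x).im + b • J‖ ^ 2 = (x.1.im + b) ^ 2 + ‖x.2‖ ^ 2) (x : ℂ × ℂ) :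
    ‖T x‖ = pairNorm x := by
  have h := him x 0
  rw [zero_smul, add_zero, add_zero] at h
  refine (pow_left_inj₀ (norm_nonneg _) (pairNorm_nonneg _) two_ne_zero).1 ?_
  rw [norm_sq_eq_re_im, h, hre, pairNorm_sq, ← Complex.normSq_eq_norm_sq x.1,
    Complex.normSq_apply]
  ring

end Frame

/-! ### Comparison of the shell with the sphere in ℍ -/

section SphereMeasure

open scoped ENNReal

lemma measurable_sphereParam (c : ℍ) (r : ℝ) (hr : 0 < r) : Measurable (sphereParam c r hr) := by
  refine Measurable.subtype_mk ?_
  exact (continuous_const.add (continuous_subtype_val.const_smul r)).measurable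

lemma lintegral_sphereSurfaceMeasure (c : ℍ) (r : ℝ) (hr : 0 < r) {h : ℍ → ℝ≥0∞}
    (hh : Measurable h) :
    ∫⁻ q : sphere c r, h q ∂(sphereSurfaceMeasure c r hr) = ENNReal.ofReal (r ^ 3) *
      ∫⁻ u : sphere (0 : ℍ) 1, h (c + r • (u : ℍ)) ∂(volume : Measure ℍ).toSphere := by
  rw [sphereSurfaceMeasure, lintegral_smul_measure,
    lintegral_map (f := fun q : sphere c r => h q) (hh.comp measurable_subtype_coe)
      (measurable_sphereParam c r hr)]
  rfl

instance isFiniteMeasure_sphereSurfaceMeasure (c : ℍ) (r : ℝ) (hr : 0 < r) :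
    IsFiniteMeasure (sphereSurfaceMeasure c r hr) := by
  unfold sphereSurfaceMeasure
  exact Measure.smul_finite _ ENNReal.ofReal_ne_top

/-- `T` carries Lebesgue measure to a Haar measure, hence to a multiple k of the volume, and the
shell into the punctured unit ball; the cone comparison then applies. -/
lemma exists_lintegral_shell_le_sphere (c : ℍ) (r : ℝ) (hr : 0 < r) (T : (ℂ × ℂ) ≃L[ℝ] ℍ)
    (hT : ∀ x, ‖T x‖ = pairNorm x) :
    ∃ M : ℝ, 0 < M ∧ ∀ h : ℍ → ℝ≥0∞, Measurable h →
      ∫⁻ x in shell, h (c + r • ((pairNorm x)⁻¹ • T x)) ≤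
        ENNReal.ofReal M * ∫⁻ q : sphere c r, h q ∂(sphereSurfaceMeasure c r hr) := by
  have hTm : Measurable T := T.continuous.measurable
  have : (Measure.map T (volume : Measure (ℂ × ℂ))).IsAddHaarMeasure :=
    T.isAddHaarMeasure_map volume
  obtain ⟨k, hk, hk', hkT⟩ : ∃ k : ℝ≥0∞, k ≠ 0 ∧ k ≠ ∞ ∧
      Measure.map T (volume : Measure (ℂ × ℂ)) = k • (volume : Measure ℍ) := by
    refine ⟨(Measure.map T volume).addHaarScalarFactor (volume : Measure ℍ), ?_,
      ENNReal.coe_ne_top, Measure.isAddLeftInvariant_eq_smul _ _⟩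
    exact_mod_cast (Measure.addHaarScalarFactor_pos_of_isAddHaarMeasure _ _).ne'
  refine ⟨k.toReal / r ^ 3, div_pos (ENNReal.toReal_pos hk hk') (by positivity), fun h hh => ?_⟩
  set G : ℍ → ℝ≥0∞ := fun y => h (c + r • y) with hG
  have hGm : Measurable G := hh.comp (by fun_prop)
  have hGm' : Measurable fun y : ℍ => G (‖y‖⁻¹ • y) :=
    hGm.comp (measurable_norm.inv.smul measurable_id)
  have hset : MeasurableSet (ball (0 : ℍ) 1 \ {0}) :=
    measurableSet_ball.diff (measurableSet_singleton 0)
  calc ∫⁻ x in shell, h (c + r • ((pairNorm x)⁻¹ • T x))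
      = ∫⁻ x in shell, G (‖T x‖⁻¹ • T x) := by simp_rw [hT]; rfl
    _ ≤ ∫⁻ x in T ⁻¹' (ball (0 : ℍ) 1 \ {0}), G (‖T x‖⁻¹ • T x) := by
        refine lintegral_mono_set fun x hx => ⟨?_, ?_⟩
        · rw [mem_ball_zero_iff, hT]; exact hx.2
        · intro h0
          have h1 : ‖T x‖ = 0 := by rw [h0, norm_zero]
          rw [hT] at h1
          linarith [hx.1]
    _ = k * ∫⁻ y in ball (0 : ℍ) 1 \ {0}, G (‖y‖⁻¹ • y) := by
        rw [← setLIntegral_map hset hGm' hTm, hkT, Measure.restrict_smul, lintegral_smul_measure]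
        rfl
    _ ≤ k * ∫⁻ u : sphere (0 : ℍ) 1, G u ∂(volume : Measure ℍ).toSphere := by
        gcongr
        exact lintegral_normalize_le_toSphere volume hGm
    _ = _ := by
        rw [lintegral_sphereSurfaceMeasure c r hr hh, ← mul_assoc,
          ← ENNReal.ofReal_mul (by positivity),
          div_mul_cancel₀ _ (by positivity), ENNReal.ofReal_toReal hk']

end SphereMeasure

/-! ### Recovering the stem function from two values on the sphere -/

section Slice

open scoped ENNReal

/-- The point `α + i β` of the closed upper half plane with `q = α + I β`. -/
noncomputable def sliceCoord (q : ℍ) : ℂ := ⟨q.re, ‖q.im‖⟩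

/-- The imaginary unit `I` with `q = α + I β`, `β > 0` (and `0` if `q` is real). -/
noncomputable def sliceUnit (q : ℍ) : ℍ := ‖q.im‖⁻¹ • q.im

/-- The value at `q` of the slice function induced by `F₁ + F₂ ι`. -/
noncomputable def sliceValue (F₁ F₂ : ℂ → ℍ) (q : ℍ) : ℍ :=
  F₁ (sliceCoord q) + sliceUnit q * F₂ (sliceCoord q)

lemma continuous_sliceCoord : Continuous sliceCoord := by
  have : sliceCoord = fun q : ℍ => (q.re : ℂ) + (‖q.im‖ : ℂ) * Complex.I := by
    ext q; exact Complex.mk_eq_add_mul_I _ _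
  rw [this]
  have h1 := Quaternion.continuous_re
  have h2 := Quaternion.continuous_im
  fun_prop

lemma measurable_sliceUnit : Measurable sliceUnit :=
  Quaternion.continuous_im.measurable.norm.inv.smul Quaternion.continuous_im.measurable

lemma measurable_sliceValue {F₁ F₂ : ℂ → ℍ} (h₁ : Measurable F₁) (h₂ : Measurable F₂) :
    Measurable (sliceValue F₁ F₂) :=
  (h₁.comp continuous_sliceCoord.measurable).add
    (measurable_sliceUnit.mul (h₂.comp continuous_sliceCoord.measurable))

lemma norm_sliceUnit_le (q : ℍ) : ‖sliceUnit q‖ ≤ 1 := by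
  rw [sliceUnit, norm_smul, norm_inv, norm_norm]
  exact inv_mul_le_one

/-- The map sending the orthogonal projection `v` of `u ∈ S³` to the plane `ℝ + ℝ J`, identified
with `ℂ`, to the slice coordinate of `a + b J + r u`. -/
noncomputable def discParam (a b r : ℝ) (v : ℂ) : ℂ :=
  ⟨a + r * v.re, Real.sqrt ((b + r * v.im) ^ 2 + r ^ 2 * (1 - ‖v‖ ^ 2))⟩

lemma continuous_discParam (a b r : ℝ) : Continuous (discParam a b r) := by
  have : discParam a b r = fun v => ((a + r * v.re : ℝ) : ℂ) +
      (Real.sqrt ((b + r * v.im) ^ 2 + r ^ 2 * (1 - ‖v‖ ^ 2)) : ℂ) * Complex.I := by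
    ext q; exact Complex.mk_eq_add_mul_I _ _
  rw [this]
  fun_prop

/-- The difference of the two values is (I - I')A₂, which controls A₂ with a loss of the factor s;
then A₁ is the first value minus I A₂. The bound ‖I‖ ≤ 1 also admits the value 0 of `sliceUnit` at
real points. -/
lemma two_point_estimate {A₁ A₂ I I' : ℍ} {r s β B : ℝ} (hr : 0 < r) (hI : ‖I‖ ≤ 1)
    (hβ0 : 0 ≤ β) (hβ : β ≤ B) (hs0 : 0 ≤ s) (hs : s ≤ 1)
    (hII : β ^ 2 * ‖I - I'‖ ^ 2 = 4 * r ^ 2 * s) :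
    s * (‖A₁‖ ^ 2 + ‖A₂‖ ^ 2) ≤
      (2 + 3 * B ^ 2 / (2 * r ^ 2)) * (‖A₁ + I * A₂‖ ^ 2 + ‖A₁ + I' * A₂‖ ^ 2) := by
  set X := A₁ + I * A₂ with hX
  set Y := A₁ + I' * A₂ with hY
  set S := ‖X‖ ^ 2 + ‖Y‖ ^ 2 with hS
  have hS0 : 0 ≤ S := by positivity
  have h1 : ‖I - I'‖ * ‖A₂‖ ≤ ‖X‖ + ‖Y‖ := by
    rw [← norm_mul, show (I - I') * A₂ = X - Y by rw [hX, hY, sub_mul]; abel]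
    exact norm_sub_le _ _
  have h2 : ‖I - I'‖ ^ 2 * ‖A₂‖ ^ 2 ≤ 2 * S := by
    have h3 := mul_self_le_mul_self (by positivity) h1
    nlinarith [sq_nonneg (‖X‖ - ‖Y‖)]
  have h4 : ‖A₁‖ ≤ ‖X‖ + ‖A₂‖ := by
    have h5 : A₁ = X - I * A₂ := by rw [hX]; abel
    calc ‖A₁‖ = ‖X - I * A₂‖ := by rw [← h5]
      _ ≤ ‖X‖ + ‖I * A₂‖ := norm_sub_le _ _
      _ ≤ ‖X‖ + ‖A₂‖ := by
        rw [norm_mul]; gcongr; exact mul_le_of_le_one_left (norm_nonneg _) hI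
  have h6 : ‖A₁‖ ^ 2 ≤ 2 * ‖X‖ ^ 2 + 2 * ‖A₂‖ ^ 2 := by
    have h3 := mul_self_le_mul_self (norm_nonneg _) h4
    nlinarith [sq_nonneg (‖X‖ - ‖A₂‖)]
  have h7 : s * ‖A₂‖ ^ 2 ≤ B ^ 2 / (2 * r ^ 2) * S := by
    rw [div_mul_eq_mul_div, le_div_iff₀ (by positivity)]
    have h8 : β ^ 2 ≤ B ^ 2 := by gcongr
    have h9 : β ^ 2 * (‖I - I'‖ ^ 2 * ‖A₂‖ ^ 2) ≤ B ^ 2 * (2 * S) := by gcongr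
    rw [← mul_assoc, hII] at h9
    linarith
  have h10 : s * ‖A₁‖ ^ 2 ≤ 2 * S + 2 * (s * ‖A₂‖ ^ 2) := by
    have h11 : s * ‖A₁‖ ^ 2 ≤ s * (2 * ‖X‖ ^ 2 + 2 * ‖A₂‖ ^ 2) := by gcongr
    have h12 : s * ‖X‖ ^ 2 ≤ 1 * ‖X‖ ^ 2 := by gcongr
    nlinarith [sq_nonneg ‖Y‖]
  have h13 : (2 + 3 * B ^ 2 / (2 * r ^ 2)) * S = 2 * S + 3 * (B ^ 2 / (2 * r ^ 2) * S) := by ring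
  rw [h13, mul_add]
  linarith

/-- The point of the sphere of center `c` and radius `r` in direction `T x`. -/
noncomputable def spherePoint (T : (ℂ × ℂ) ≃L[ℝ] ℍ) (c : ℍ) (r : ℝ) (x : ℂ × ℂ) : ℍ :=
  c + r • ((pairNorm x)⁻¹ • T x)

lemma measurable_spherePoint (T : (ℂ × ℂ) ≃L[ℝ] ℍ) (c : ℍ) (r : ℝ) :
    Measurable (spherePoint T c r) :=
  measurable_const.add
    ((continuous_pairNorm.measurable.inv.smul T.continuous.measurable).const_smul r)

variable {J : ℍ} {T : (ℂ × ℂ) ≃L[ℝ] ℍ} {a b r : ℝ} {c : ℍ}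

lemma im_spherePoint (hc : c.im = b • J) (x : ℂ × ℂ) :
    (spherePoint T c r x).im = (T ((r * (pairNorm x)⁻¹) • x)).im + b • J := by
  rw [spherePoint, Quaternion.im_add, hc, map_smul, smul_smul, add_comm]

/-- Pythagoras: the component orthogonal to ℝ + ℝJ enters only through its squared length r²(1 -
|v|²). -/
lemma sliceCoord_spherePoint (hre : ∀ x, (T x).re = x.1.re)
    (him : ∀ x (b : ℝ), ‖(T x).im + b • J‖ ^ 2 = (x.1.im + b) ^ 2 + ‖x.2‖ ^ 2)
    (hca : c.re = a) (hc : c.im = b • J) {x : ℂ × ℂ} (hx : pairNorm x ≠ 0) :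
    sliceCoord (spherePoint T c r x) = discParam a b r ((pairNorm x)⁻¹ • x.1) := by
  have h1 : ‖(spherePoint T c r x).im‖ ^ 2 = (b + r * ((pairNorm x)⁻¹ • x.1).im) ^ 2 +
      r ^ 2 * (1 - ‖(pairNorm x)⁻¹ • x.1‖ ^ 2) := by
    rw [im_spherePoint hc, him]
    simp only [Prod.smul_fst, Prod.smul_snd, Complex.smul_im, norm_smul, smul_eq_mul, norm_mul,
      norm_inv, mul_pow, inv_pow, Real.norm_eq_abs, sq_abs]
    have h2 := pairNorm_sq x
    have h3 : ‖x.2‖ ^ 2 = pairNorm x ^ 2 - ‖x.1‖ ^ 2 := by linarith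
    rw [h3]
    field_simp
    ring
  refine Complex.ext ?_ ?_
  · simp [sliceCoord, discParam, spherePoint, hre, hca]
  · simp only [sliceCoord, discParam]
    rw [← h1, Real.sqrt_sq (norm_nonneg _)]

/-- Replacing x.2 by -x.2 preserves the slice coordinate and moves the imaginary part by 2r√(1 -
|v|²), where v is the normalized first component. This is the input of `two_point_estimate`, with β
≤ b + r. -/
lemma slice_estimate (hre : ∀ x, (T x).re = x.1.re)
    (him : ∀ x (b : ℝ), ‖(T x).im + b • J‖ ^ 2 = (x.1.im + b) ^ 2 + ‖x.2‖ ^ 2)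
    (hb : 0 ≤ b) (hr : 0 < r)
    (hca : c.re = a) (hc : c.im = b • J) (F₁ F₂ : ℂ → ℍ) {x : ℂ × ℂ} (hx : pairNorm x ≠ 0) :
    (1 - ‖(pairNorm x)⁻¹ • x.1‖ ^ 2) *
      (‖F₁ (discParam a b r ((pairNorm x)⁻¹ • x.1))‖ ^ 2 +
        ‖F₂ (discParam a b r ((pairNorm x)⁻¹ • x.1))‖ ^ 2) ≤
    (2 + 3 * (b + r) ^ 2 / (2 * r ^ 2)) *
      (‖sliceValue F₁ F₂ (spherePoint T c r x)‖ ^ 2 +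
        ‖sliceValue F₁ F₂ (spherePoint T c r (x.1, -x.2))‖ ^ 2) := by
  have hn : pairNorm (x.1, -x.2) = pairNorm x := by simp [pairNorm]
  have hz := sliceCoord_spherePoint (r := r) hre him hca hc hx
  have hz' := sliceCoord_spherePoint (r := r) (x := (x.1, -x.2)) hre him hca hc (by rwa [hn])
  rw [hn] at hz'
  have hβ : ‖(spherePoint T c r (x.1, -x.2)).im‖ = ‖(spherePoint T c r x).im‖ :=
    congrArg Complex.im (hz'.trans hz.symm)
  have hs : 1 - ‖(pairNorm x)⁻¹ • x.1‖ ^ 2 = ((pairNorm x)⁻¹ * ‖x.2‖) ^ 2 := by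
    rw [norm_smul, norm_inv, Real.norm_of_nonneg (pairNorm_nonneg x), mul_pow, mul_pow, inv_pow]
    have h2 := pairNorm_sq x
    field_simp
    linarith
  have hdiff : ‖(spherePoint T c r x).im - (spherePoint T c r (x.1, -x.2)).im‖ ^ 2 =
      4 * r ^ 2 * (1 - ‖(pairNorm x)⁻¹ • x.1‖ ^ 2) := by
    rw [im_spherePoint hc, im_spherePoint hc, hn, add_sub_add_right_eq_sub, ← Quaternion.im_sub,
      ← map_sub, ← smul_sub]
    have h3 := him ((r * (pairNorm x)⁻¹) • (x - (x.1, -x.2))) 0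
    rw [zero_smul, add_zero, add_zero] at h3
    rw [h3, hs]
    simp only [Prod.smul_fst, Prod.smul_snd, Prod.fst_sub, Prod.snd_sub, sub_self, smul_zero,
      Complex.zero_im, norm_smul, sub_neg_eq_add, ← two_mul, norm_mul, Complex.norm_ofNat,
      Real.norm_eq_abs, abs_of_pos hr, abs_inv, abs_of_nonneg (pairNorm_nonneg x)]
    ring
  have hle : ‖(spherePoint T c r x).im‖ ≤ b + r := by
    have h1 : ‖(spherePoint T c r x).im‖ ^ 2 ≤ (b + r) ^ 2 := by
      rw [im_spherePoint hc, him]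
      simp only [Prod.smul_fst, Prod.smul_snd, Complex.smul_im, norm_smul, smul_eq_mul, norm_mul,
        norm_inv, mul_pow, inv_pow, Real.norm_eq_abs, sq_abs]
      have h2 := pairNorm_sq x
      have h4 : x.1.im ^ 2 ≤ ‖x.1‖ ^ 2 := by
        rw [← Complex.normSq_eq_norm_sq, Complex.normSq_apply]; nlinarith [sq_nonneg x.1.re]
      have hp : 0 < pairNorm x := lt_of_le_of_ne (pairNorm_nonneg x) hx.symm
      have h5 : x.1.im ≤ pairNorm x := by
        refine le_of_sq_le_sq ?_ hp.le
        nlinarith [sq_nonneg ‖x.2‖]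
      have h6 : (r * (pairNorm x)⁻¹ * x.1.im + b) ^ 2 + r ^ 2 * (pairNorm x ^ 2)⁻¹ * ‖x.2‖ ^ 2 =
          r ^ 2 * ((x.1.im ^ 2 + ‖x.2‖ ^ 2) / pairNorm x ^ 2) +
            2 * b * r * (x.1.im / pairNorm x) + b ^ 2 := by
        field_simp; ring
      rw [h6]
      have h7 : (x.1.im ^ 2 + ‖x.2‖ ^ 2) / pairNorm x ^ 2 ≤ 1 := by
        rw [div_le_one (by positivity)]; linarith
      have h8 : x.1.im / pairNorm x ≤ 1 := by rwa [div_le_one hp]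
      have h9 : r ^ 2 * ((x.1.im ^ 2 + ‖x.2‖ ^ 2) / pairNorm x ^ 2) ≤ r ^ 2 * 1 := by gcongr
      have h10 : 2 * b * r * (x.1.im / pairNorm x) ≤ 2 * b * r * 1 := by gcongr
      nlinarith
    exact le_of_sq_le_sq h1 (by positivity)
  have hs0 : 0 ≤ 1 - ‖(pairNorm x)⁻¹ • x.1‖ ^ 2 := by rw [hs]; positivity
  rw [sliceValue, sliceValue, hz, hz']
  refine two_point_estimate hr (norm_sliceUnit_le _) (norm_nonneg _) hle hs0
    (by linarith [sq_nonneg ‖(pairNorm x)⁻¹ • x.1‖]) ?_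
  -- If β = 0, both imaginary parts vanish and their distance formula forces 1 - |v|² = 0.
  by_cases h0 : ‖(spherePoint T c r x).im‖ = 0
  · have h1 : (spherePoint T c r x).im = 0 := norm_eq_zero.1 h0
    have h2 : (spherePoint T c r (x.1, -x.2)).im = 0 := norm_eq_zero.1 (hβ.trans h0)
    rw [← hdiff, h1, h2]; simp
  · rw [sliceUnit, sliceUnit, hβ, ← smul_sub, norm_smul, mul_pow, hdiff, norm_inv, norm_norm]
    field_simp

/-- One factor 1 - |v|² pays for passing from the disc to the shell, the other for solving for F₁
and F₂ from two values. -/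
lemma exists_lintegral_disc_le_sphere (hJ : J * J = -1) (hb : 0 ≤ b) (hr : 0 < r)
    (hca : c.re = a) (hc : c.im = b • J) :
    ∃ M : ℝ, 0 < M ∧ ∀ F₁ F₂ : ℂ → ℍ, Measurable F₁ → Measurable F₂ →
      ∫⁻ v in ball (0 : ℂ) 1, ENNReal.ofReal ((1 - ‖v‖ ^ 2) ^ 2 *
        (‖F₁ (discParam a b r v)‖ ^ 2 + ‖F₂ (discParam a b r v)‖ ^ 2)) ≤
      ENNReal.ofReal M * ∫⁻ q : sphere c r, ENNReal.ofReal (‖sliceValue F₁ F₂ q‖ ^ 2)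
        ∂(sphereSurfaceMeasure c r hr) := by
  obtain ⟨T, hre, him⟩ := exists_frame hJ
  obtain ⟨M₁, hM₁, h₁⟩ := exists_lintegral_disc_le_shell
  obtain ⟨M₂, hM₂, h₂⟩ := exists_lintegral_shell_le_sphere c r hr T (norm_frame hre him)
  set K := 2 + 3 * (b + r) ^ 2 / (2 * r ^ 2) with hK
  have hK0 : 0 < K := by positivity
  refine ⟨M₁ * (K * (2 * M₂)), by positivity, fun F₁ F₂ hF₁ hF₂ => ?_⟩
  set h : ℍ → ℝ≥0∞ := fun q => ENNReal.ofReal (‖sliceValue F₁ F₂ q‖ ^ 2) with hh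
  have hhm : Measurable h := ((measurable_sliceValue hF₁ hF₂).norm.pow_const 2).ennreal_ofReal
  set g : ℂ → ℝ≥0∞ := fun v => ENNReal.ofReal ((1 - ‖v‖ ^ 2) *
    (‖F₁ (discParam a b r v)‖ ^ 2 + ‖F₂ (discParam a b r v)‖ ^ 2)) with hg
  have hgm : Measurable g := by
    have e := (continuous_discParam a b r).measurable
    have e1 := (hF₁.comp e).norm.pow_const 2
    have e2 := (hF₂.comp e).norm.pow_const 2
    have e3 : Measurable fun v : ℂ => 1 - ‖v‖ ^ 2 := by fun_prop
    exact (e3.mul (e1.add e2)).ennreal_ofReal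
  have hhp : Measurable fun x => h (spherePoint T c r x) :=
    hhm.comp (measurable_spherePoint T c r)
  -- The reflection preserves the shell and its measure, so both values in the estimate have the
  -- same integral.
  set R : ℂ × ℂ → ℂ × ℂ := Prod.map id Neg.neg with hR
  have hRm : MeasurePreserving R (volume : Measure (ℂ × ℂ)) volume :=
    (MeasurePreserving.id volume).prod (Measure.measurePreserving_neg volume)
  have hRn : ∀ x, pairNorm (R x) = pairNorm x := fun x => by simp [pairNorm, hR]
  have hRs : R ⁻¹' shell = shell := by
    ext x; simp [shell, hRn]
  have hrefl : ∫⁻ x in shell, h (spherePoint T c r (R x)) =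
      ∫⁻ x in shell, h (spherePoint T c r x) := by
    have := hRm.setLIntegral_comp_preimage isOpen_shell.measurableSet hhp
    rwa [hRs] at this
  calc ∫⁻ v in ball (0 : ℂ) 1, ENNReal.ofReal ((1 - ‖v‖ ^ 2) ^ 2 *
        (‖F₁ (discParam a b r v)‖ ^ 2 + ‖F₂ (discParam a b r v)‖ ^ 2))
      = ∫⁻ v in ball (0 : ℂ) 1, ENNReal.ofReal (1 - ‖v‖ ^ 2) * g v := by
        refine setLIntegral_congr_fun measurableSet_ball fun v hv => ?_
        have hv1 : ‖v‖ < 1 := by simpa using hv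
        have hv2 : 0 ≤ 1 - ‖v‖ ^ 2 := by nlinarith [norm_nonneg v]
        simp only [hg]
        rw [← ENNReal.ofReal_mul hv2]
        congr 1; ring
    _ ≤ ENNReal.ofReal M₁ * ∫⁻ x in shell, g ((pairNorm x)⁻¹ • x.1) := h₁ g hgm
    _ ≤ ENNReal.ofReal M₁ * ∫⁻ x in shell, ENNReal.ofReal K *
          (h (spherePoint T c r x) + h (spherePoint T c r (R x))) := by
        refine mul_le_mul' le_rfl (setLIntegral_mono' isOpen_shell.measurableSet fun x hx => ?_)
        have hx0 : pairNorm x ≠ 0 := by have := hx.1; positivity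
        simp only [hg, hh]
        rw [← ENNReal.ofReal_add (by positivity) (by positivity), ← ENNReal.ofReal_mul hK0.le]
        exact ENNReal.ofReal_le_ofReal (slice_estimate hre him hb hr hca hc F₁ F₂ hx0)
    _ = ENNReal.ofReal M₁ * (ENNReal.ofReal K * (2 * ∫⁻ x in shell, h (spherePoint T c r x))) := by
        rw [lintegral_const_mul' _ _ ENNReal.ofReal_ne_top, lintegral_add_left hhp, hrefl, two_mul]
    _ ≤ ENNReal.ofReal M₁ * (ENNReal.ofReal K * (2 * (ENNReal.ofReal M₂ *
          ∫⁻ q : sphere c r, h q ∂(sphereSurfaceMeasure c r hr)))) := by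
        gcongr
        exact h₂ h hhm
    _ = _ := by
        rw [ENNReal.ofReal_mul hM₁.le, ENNReal.ofReal_mul hK0.le, ENNReal.ofReal_mul zero_le_two,
          ENNReal.ofReal_ofNat]
        ring

end Slice

/-! ### Cauchy and mean value estimates -/

section CircleEstimates

open scoped ENNReal

/-- Cauchy's formula, with the kernel (ζ - c)/(ζ - w) bounded by R/(R - |w - c|) on the circle. -/
lemma norm_le_integral_circle {F : ℂ → ℂ} {D : Set ℂ} {c w : ℂ} {R : ℝ}
    (hF : DifferentiableOn ℂ F D) (hR : 0 < R) (hc : closedBall c R ⊆ D) (hw : w ∈ ball c R) :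
    2 * Real.pi * ‖F w‖ ≤
      R / (R - ‖w - c‖) * ∫ θ in -Real.pi..Real.pi, ‖F (circleMap c R θ)‖ := by
  have hwR : ‖w - c‖ < R := by simpa [dist_eq_norm] using hw
  have hd : DiffContOnCl ℂ F (ball c |R|) := by
    rw [abs_of_pos hR]
    exact (hF.mono hc).diffContOnCl_ball subset_rfl
  have h1 := hd.circleAverage_smul_div (w := w) (by rwa [abs_of_pos hR])
  rw [Real.circleAverage_def] at h1
  have hcont : Continuous fun θ => F (circleMap c R θ) :=
    hF.continuousOn.comp_continuous (continuous_circleMap c R)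
      fun θ => hc (circleMap_mem_closedBall c hR.le θ)
  have hne : ∀ θ, circleMap c R θ - w ≠ 0 := fun θ h => by
    have h2 : circleMap c R θ = w := sub_eq_zero.1 h
    have h3 := circleMap_mem_sphere c hR.le θ
    rw [h2, mem_sphere, dist_eq_norm] at h3
    linarith
  have hcont2 : Continuous fun θ =>
      ((circleMap c R θ - c) / (circleMap c R θ - w)) • F (circleMap c R θ) := by
    refine Continuous.smul (Continuous.div ?_ ?_ hne) hcont
    · exact (continuous_circleMap c R).sub continuous_const
    · exact (continuous_circleMap c R).sub continuous_const
  have hpt : ∀ θ, ‖((circleMap c R θ - c) / (circleMap c R θ - w)) • F (circleMap c R θ)‖ ≤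
      R / (R - ‖w - c‖) * ‖F (circleMap c R θ)‖ := by
    intro θ
    rw [norm_smul, norm_div]
    have h3 : ‖circleMap c R θ - c‖ = R := by
      have := circleMap_mem_sphere c hR.le θ
      rwa [mem_sphere, dist_eq_norm] at this
    have h4 : R - ‖w - c‖ ≤ ‖circleMap c R θ - w‖ := by
      have := norm_sub_norm_le (circleMap c R θ - c) (w - c)
      rwa [sub_sub_sub_cancel_right, h3] at this
    have h5 : 0 < R - ‖w - c‖ := by linarith
    rw [h3]
    gcongr
  have hper : ∫ θ in (0 : ℝ)..2 * Real.pi, ‖F (circleMap c R θ)‖ =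
      ∫ θ in -Real.pi..Real.pi, ‖F (circleMap c R θ)‖ := by
    have hp : Function.Periodic (fun θ => ‖F (circleMap c R θ)‖) (2 * Real.pi) := fun θ => by
      simp only [periodic_circleMap c R θ]
    have := hp.intervalIntegral_add_eq 0 (-Real.pi)
    rw [zero_add, show -Real.pi + 2 * Real.pi = Real.pi by ring] at this
    exact this
  rw [← h1, norm_smul, Real.norm_of_nonneg (by positivity), mul_inv_cancel_left₀ (by positivity),
    ← hper, ← intervalIntegral.integral_const_mul]
  refine (intervalIntegral.norm_integral_le_integral_norm (by positivity)).trans ?_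
  refine intervalIntegral.integral_mono_on (by positivity) ?_ ?_ fun θ _ => hpt θ
  · exact hcont2.norm.intervalIntegrable _ _
  · exact (continuous_const.mul hcont.norm).intervalIntegrable _ _

lemma sq_norm_le_lintegral_circle {g : ℂ → ℂ} {D : Set ℂ} {w : ℂ} {R : ℝ}
    (hg : DifferentiableOn ℂ g D) (hR : 0 < R) (hw : closedBall w R ⊆ D) :
    ENNReal.ofReal (2 * Real.pi * ‖g w‖ ^ 2) ≤
      ∫⁻ θ in Set.Ioo (-Real.pi) Real.pi, ENNReal.ofReal (‖g (circleMap w R θ)‖ ^ 2) := by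
  have h1 := norm_le_integral_circle (hg.pow 2) hR hw (mem_ball_self hR)
  have hcont : Continuous fun θ => ‖g (circleMap w R θ)‖ ^ 2 :=
    (hg.continuousOn.comp_continuous (continuous_circleMap w R)
      fun θ => hw (circleMap_mem_closedBall w hR.le θ)).norm.pow 2
  have hpi := Real.pi_pos
  rw [sub_self, norm_zero, sub_zero, div_self hR.ne', one_mul] at h1
  simp only [Pi.pow_apply, norm_pow] at h1
  rw [intervalIntegral.integral_of_le (by linarith), integral_Ioc_eq_integral_Ioo] at h1
  refine (ENNReal.ofReal_le_ofReal h1).trans ?_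
  rw [ofReal_integral_eq_lintegral_ofReal]
  · exact (hcont.integrableOn_Icc).mono_set Set.Ioo_subset_Icc_self
  · filter_upwards with θ using by positivity

/-- The circle estimate for g² integrated against ρ dρ in polar coordinates. -/
lemma sq_norm_le_lintegral_ball {g : ℂ → ℂ} {D : Set ℂ} {w : ℂ} {ε : ℝ} (hgm : Measurable g)
    (hg : DifferentiableOn ℂ g D) (hε : 0 < ε) (hw : closedBall w ε ⊆ D) :
    ENNReal.ofReal (Real.pi * ε ^ 2 * ‖g w‖ ^ 2) ≤
      ∫⁻ z in ball w ε, ENNReal.ofReal (‖g z‖ ^ 2) := by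
  set G : ℂ → ℝ≥0∞ := (ball w ε).indicator fun z => ENNReal.ofReal (‖g z‖ ^ 2) with hG
  have hGm : Measurable G := ((hgm.norm.pow_const 2).ennreal_ofReal).indicator measurableSet_ball
  rw [← lintegral_indicator measurableSet_ball, ← hG,
    ← lintegral_add_left_eq_self G w, ← Complex.lintegral_comp_polarCoord_symm]
  have hsub : Set.Ioo 0 ε ×ˢ Set.Ioo (-Real.pi) Real.pi ⊆ polarCoord.target := by
    rintro ⟨ρ, θ⟩ ⟨h1, h2⟩
    exact ⟨h1.1, h2⟩
  refine le_trans ?_ (lintegral_mono_set hsub)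
  have hval : ∀ ρ θ : ℝ, w + Complex.polarCoord.symm (ρ, θ) = circleMap w ρ θ := by
    intro ρ θ
    rw [Complex.polarCoord_symm_apply, circleMap, Complex.exp_mul_I]
    simp
  have hmeas : Measurable fun p : ℝ × ℝ =>
      ENNReal.ofReal p.1 • G (w + Complex.polarCoord.symm p) := by
    have h1 : Measurable fun p : ℝ × ℝ => w + Complex.polarCoord.symm p := by
      have : (fun p : ℝ × ℝ => w + Complex.polarCoord.symm p) =
          fun p => w + (p.1 : ℂ) * Complex.exp (p.2 * Complex.I) := by
        ext p; exact hval p.1 p.2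
      rw [this]
      fun_prop
    exact (measurable_fst.ennreal_ofReal).smul (hGm.comp h1)
  rw [Measure.volume_eq_prod, ← Measure.prod_restrict, lintegral_prod _ hmeas.aemeasurable]
  have hinner : ∀ ρ ∈ Set.Ioo 0 ε, ENNReal.ofReal (ρ * (2 * Real.pi * ‖g w‖ ^ 2)) ≤
      ∫⁻ θ in Set.Ioo (-Real.pi) Real.pi,
        ENNReal.ofReal ρ • G (w + Complex.polarCoord.symm (ρ, θ)) := by
    intro ρ hρ
    have h1 := sq_norm_le_lintegral_circle hg hρ.1
      ((closedBall_subset_closedBall hρ.2.le).trans hw)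
    simp_rw [smul_eq_mul]
    rw [lintegral_const_mul' _ _ ENNReal.ofReal_ne_top, ENNReal.ofReal_mul hρ.1.le]
    refine mul_le_mul' le_rfl (h1.trans (lintegral_mono fun θ => ?_))
    have h2 : circleMap w ρ θ ∈ ball w ε := by
      rw [mem_ball, dist_eq_norm]
      simpa [abs_of_pos hρ.1] using hρ.2
    simp only [hval, hG]
    rw [Set.indicator_of_mem h2]
  refine le_trans ?_ (setLIntegral_mono' measurableSet_Ioo hinner)
  have hpi := Real.pi_pos
  rw [← ofReal_integral_eq_lintegral_ofReal]
  · rw [← integral_Ioc_eq_integral_Ioo, ← intervalIntegral.integral_of_le hε.le,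
      intervalIntegral.integral_mul_const, integral_id]
    refine ENNReal.ofReal_le_ofReal (le_of_eq ?_)
    ring
  · exact ((continuous_id.mul continuous_const).integrableOn_Icc).mono_set Set.Ioo_subset_Icc_self
  · filter_upwards [ae_restrict_mem measurableSet_Ioo] with ρ hρ
    have := hρ.1
    exact mul_nonneg this.le (by positivity)

end CircleEstimates

/-! ### Point evaluation when the center is real -/

section RealCenter

open scoped ENNReal

lemma discParam_zero {a r x y : ℝ} (hr : 0 < r) :
    discParam a 0 r ⟨x, y⟩ = ⟨a + r * x, r * Real.sqrt (1 - x ^ 2)⟩ := by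
  rw [discParam, ← Complex.normSq_eq_norm_sq, Complex.normSq_apply]
  congr 1
  rw [show (0 + r * y) ^ 2 + r ^ 2 * (1 - (x * x + y * y)) = r ^ 2 * (1 - x ^ 2) by ring,
    Real.sqrt_mul (by positivity), Real.sqrt_sq hr.le]

/-- For b = 0 the slice coordinate depends only on x = Re v. On |Im v| < √(1 - x²)/2 one has 1 -
|v|² ≥ (3/4)(1 - x²), whence 9/16; integrating out Im v gives √(1 - x²), and x = cos θ gives one
more sine, in all sin⁶ θ. -/
lemma lintegral_halfCircle_le {a r Q : ℝ} (hr : 0 < r) {g : ℂ → ℂ} (hgm : Measurable g)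
    (hQ : ∫⁻ v in ball (0 : ℂ) 1, ENNReal.ofReal ((1 - ‖v‖ ^ 2) ^ 2 *
      ‖g (discParam a 0 r v)‖ ^ 2) ≤ ENNReal.ofReal Q) :
    ∫⁻ θ in Set.Ioo 0 Real.pi, ENNReal.ofReal (9 / 16 * Real.sin θ ^ 6 *
      ‖g (circleMap a r θ)‖ ^ 2) ≤ ENNReal.ofReal Q := by
  set G : ℝ → ℝ := fun x => ‖g ⟨a + r * x, r * Real.sqrt (1 - x ^ 2)⟩‖ ^ 2 with hG
  have hGm : Measurable G := by
    have h1 : Measurable fun x : ℝ => (⟨a + r * x, r * Real.sqrt (1 - x ^ 2)⟩ : ℂ) := by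
      have : (fun x : ℝ => (⟨a + r * x, r * Real.sqrt (1 - x ^ 2)⟩ : ℂ)) = fun x =>
          ((a + r * x : ℝ) : ℂ) + ((r * Real.sqrt (1 - x ^ 2) : ℝ) : ℂ) * Complex.I := by
        ext x; exact Complex.mk_eq_add_mul_I _ _
      rw [this]
      fun_prop
    exact (hgm.comp h1).norm.pow_const 2
  let S : Set (ℝ × ℝ) := {p | p.1 ∈ Set.Ioo (-1) 1 ∧
    p.2 ∈ Set.Ioo (-(Real.sqrt (1 - p.1 ^ 2) / 2)) (Real.sqrt (1 - p.1 ^ 2) / 2)}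
  have hS : MeasurableSet S := by
    refine (measurable_fst measurableSet_Ioo).inter ?_
    refine (isOpen_lt (f := fun p : ℝ × ℝ => -(Real.sqrt (1 - p.1 ^ 2) / 2)) (g := Prod.snd)
      (by fun_prop) (by fun_prop)).measurableSet.inter (isOpen_lt (f := Prod.snd)
        (g := fun p : ℝ × ℝ => Real.sqrt (1 - p.1 ^ 2) / 2) (by fun_prop)
        (by fun_prop)).measurableSet
  have hsin : ∀ θ ∈ Set.Ioo 0 Real.pi, Real.sqrt (1 - Real.cos θ ^ 2) = Real.sin θ :=
    fun θ hθ => by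
      rw [← Real.sin_sq, Real.sqrt_sq (Real.sin_pos_of_mem_Ioo hθ).le]
  have himg : Real.cos '' Set.Ioo 0 Real.pi ⊆ Set.Ioo (-1) 1 := by
    rintro _ ⟨θ, hθ, rfl⟩
    have h1 := Real.sin_pos_of_mem_Ioo hθ
    have h2 := Real.sin_sq_add_cos_sq θ
    constructor <;> nlinarith
  calc ∫⁻ θ in Set.Ioo 0 Real.pi, ENNReal.ofReal (9 / 16 * Real.sin θ ^ 6 *
        ‖g (circleMap a r θ)‖ ^ 2)
      = ∫⁻ θ in Set.Ioo 0 Real.pi, ENNReal.ofReal |-Real.sin θ| *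
          ENNReal.ofReal (9 / 16 * (1 - Real.cos θ ^ 2) ^ 2 * G (Real.cos θ) *
            Real.sqrt (1 - Real.cos θ ^ 2)) := by
        refine setLIntegral_congr_fun measurableSet_Ioo fun θ hθ => ?_
        rw [← ENNReal.ofReal_mul (abs_nonneg _), abs_neg,
          abs_of_pos (Real.sin_pos_of_mem_Ioo hθ), hG]
        simp only
        rw [hsin θ hθ, ← Real.sin_sq]
        have : (⟨a + r * Real.cos θ, r * Real.sin θ⟩ : ℂ) = circleMap a r θ := by
          rw [circleMap, Complex.exp_mul_I]
          refine Complex.ext ?_ ?_ <;>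
            simp [Complex.cos_ofReal_re, Complex.sin_ofReal_re]
        rw [this]
        congr 1; ring
    _ = ∫⁻ x in Real.cos '' Set.Ioo 0 Real.pi, ENNReal.ofReal (9 / 16 * (1 - x ^ 2) ^ 2 * G x *
          Real.sqrt (1 - x ^ 2)) :=
        (lintegral_image_eq_lintegral_abs_deriv_mul measurableSet_Ioo
          (fun θ _ => (Real.hasDerivAt_cos θ).hasDerivWithinAt)
          (Real.injOn_cos.mono Set.Ioo_subset_Icc_self)
          fun x => ENNReal.ofReal (9 / 16 * (1 - x ^ 2) ^ 2 * G x * Real.sqrt (1 - x ^ 2))).symm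
    _ ≤ ∫⁻ x in Set.Ioo (-1) 1, ENNReal.ofReal (9 / 16 * (1 - x ^ 2) ^ 2 * G x *
          Real.sqrt (1 - x ^ 2)) := lintegral_mono_set himg
    _ = ∫⁻ p in S, ENNReal.ofReal (9 / 16 * (1 - p.1 ^ 2) ^ 2 * G p.1) := by
        rw [← lintegral_indicator hS, Measure.volume_eq_prod, lintegral_prod _
          ((Measurable.indicator (by fun_prop) hS).aemeasurable),
          ← lintegral_indicator measurableSet_Ioo]
        refine lintegral_congr fun x => ?_
        by_cases hx : x ∈ Set.Ioo (-1 : ℝ) 1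
        · rw [Set.indicator_of_mem hx]
          have h1 : ∀ y, S.indicator (fun p : ℝ × ℝ =>
              ENNReal.ofReal (9 / 16 * (1 - p.1 ^ 2) ^ 2 * G p.1)) (x, y) =
              (Set.Ioo (-(Real.sqrt (1 - x ^ 2) / 2)) (Real.sqrt (1 - x ^ 2) / 2)).indicator
                (fun _ => ENNReal.ofReal (9 / 16 * (1 - x ^ 2) ^ 2 * G x)) y := by
            intro y
            by_cases hy : y ∈ Set.Ioo (-(Real.sqrt (1 - x ^ 2) / 2)) (Real.sqrt (1 - x ^ 2) / 2)
            · rw [Set.indicator_of_mem hy, Set.indicator_of_mem (show (x, y) ∈ S from ⟨hx, hy⟩)]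
            · rw [Set.indicator_of_notMem hy,
                Set.indicator_of_notMem (show (x, y) ∉ S from fun h => hy h.2)]
          simp_rw [h1]
          rw [lintegral_indicator measurableSet_Ioo, setLIntegral_const, Real.volume_Ioo,
            ← ENNReal.ofReal_mul (by positivity)]
          congr 1; ring
        · rw [Set.indicator_of_notMem hx]
          have h1 : ∀ y, S.indicator (fun p : ℝ × ℝ =>
              ENNReal.ofReal (9 / 16 * (1 - p.1 ^ 2) ^ 2 * G p.1)) (x, y) = 0 := fun y =>
            Set.indicator_of_notMem (show (x, y) ∉ S from fun h => hx h.1) _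
          simp_rw [h1]
          exact lintegral_zero.symm
    _ ≤ ∫⁻ p in Complex.measurableEquivRealProd.symm ⁻¹' ball (0 : ℂ) 1,
          ENNReal.ofReal ((1 - ‖Complex.measurableEquivRealProd.symm p‖ ^ 2) ^ 2 *
            ‖g (discParam a 0 r (Complex.measurableEquivRealProd.symm p))‖ ^ 2) := by
        have hn : ∀ p : ℝ × ℝ, ‖Complex.measurableEquivRealProd.symm p‖ ^ 2 =
            p.1 ^ 2 + p.2 ^ 2 := fun p => by
          rw [← Complex.normSq_eq_norm_sq, Complex.normSq_apply]
          simp [Complex.measurableEquivRealProd]; ring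
        have hp2 : ∀ p ∈ S, p.2 ^ 2 ≤ (1 - p.1 ^ 2) / 4 := fun p hp => by
          have h1 : 0 ≤ 1 - p.1 ^ 2 := by nlinarith [hp.1.1, hp.1.2]
          have h2 := Real.sq_sqrt h1
          nlinarith [hp.2.1, hp.2.2]
        have hp1 : ∀ p ∈ S, 0 < 1 - p.1 ^ 2 := fun p hp => by nlinarith [hp.1.1, hp.1.2]
        refine (setLIntegral_mono' hS fun p hp => ?_).trans (lintegral_mono_set fun p hp => ?_)
        · refine ENNReal.ofReal_le_ofReal ?_
          rw [hn, show Complex.measurableEquivRealProd.symm p = ⟨p.1, p.2⟩ from rfl,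
            discParam_zero hr]
          simp only [hG]
          refine mul_le_mul_of_nonneg_right ?_ (by positivity)
          have h1 := hp1 p hp
          have h2 := hp2 p hp
          have h3 : 3 / 4 * (1 - p.1 ^ 2) ≤ 1 - (p.1 ^ 2 + p.2 ^ 2) := by linarith
          have h4 := mul_self_le_mul_self (by positivity) h3
          linarith
        · have h1 := hp1 p hp
          have h2 := hp2 p hp
          rw [Set.mem_preimage, mem_ball_zero_iff, ← sq_lt_one_iff₀ (norm_nonneg _), hn]
          linarith
    _ = ∫⁻ v in ball (0 : ℂ) 1, ENNReal.ofReal ((1 - ‖v‖ ^ 2) ^ 2 *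
          ‖g (discParam a 0 r v)‖ ^ 2) :=
        (Complex.volume_preserving_equiv_real_prod.symm).setLIntegral_comp_preimage_emb
          Complex.measurableEquivRealProd.symm.measurableEmbedding
          (fun v => ENNReal.ofReal ((1 - ‖v‖ ^ 2) ^ 2 * ‖g (discParam a 0 r v)‖ ^ 2)) _
    _ ≤ ENNReal.ofReal Q := hQ

lemma norm_circle_polynomial (a r θ : ℝ) :
    ‖(circleMap a r θ - a) ^ 2 - (r : ℂ) ^ 2‖ = 2 * r ^ 2 * |Real.sin θ| := by
  have h1 : (circleMap a r θ - a) ^ 2 - (r : ℂ) ^ 2 =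
      (r : ℂ) ^ 2 * (2 * Complex.I * Real.sin θ * Complex.exp (θ * Complex.I)) := by
    rw [circleMap, add_sub_cancel_left, Complex.exp_mul_I, ← Complex.ofReal_cos,
      ← Complex.ofReal_sin]
    have h2 : (Real.sin θ : ℂ) ^ 2 + (Real.cos θ : ℂ) ^ 2 = 1 := by
      exact_mod_cast Real.sin_sq_add_cos_sq θ
    have h3 : Complex.I ^ 2 = -1 := Complex.I_sq
    linear_combination (r : ℂ) ^ 2 * h2 + (r : ℂ) ^ 2 * (-(Real.sin θ : ℂ) ^ 2) * h3
  rw [h1, norm_mul, norm_mul, norm_mul, norm_mul, Complex.norm_exp_ofReal_mul_I, Complex.norm_I,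
    norm_pow, Complex.norm_real, Complex.norm_real, Real.norm_eq_abs, Real.norm_eq_abs, sq_abs,
    Complex.norm_ofNat]
  ring

/-- Cauchy's formula is applied to (P³g)² with P = (z - a)² - r². On the circle |P| = 2r²|sin θ|, so
|P|⁶ reproduces the weight sin⁶ θ. Symmetry of |g| carries the half circle bound to the whole
circle. -/
lemma sq_norm_le_of_real_center {a r : ℝ} (hr : 0 < r) {D : Set ℂ}
    (hDball : closedBall (a : ℂ) r ⊆ D) {z₀ : ℂ} (hz : ‖z₀ - a‖ < r) :
    ∃ K : ℝ, 0 ≤ K ∧ ∀ g : ℂ → ℂ, Measurable g → DifferentiableOn ℂ g D →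
      (∀ z ∈ D, ‖g (conj z)‖ = ‖g z‖) → ∀ Q : ℝ, 0 ≤ Q →
      ∫⁻ v in ball (0 : ℂ) 1, ENNReal.ofReal ((1 - ‖v‖ ^ 2) ^ 2 *
        ‖g (discParam a 0 r v)‖ ^ 2) ≤ ENNReal.ofReal Q →
      ‖g z₀‖ ^ 2 ≤ K * Q := by
  set P : ℂ → ℂ := fun z => (z - a) ^ 2 - (r : ℂ) ^ 2 with hP
  have hP0 : P z₀ ≠ 0 := fun h => by
    have h1 : (z₀ - a) ^ 2 = (r : ℂ) ^ 2 := sub_eq_zero.1 h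
    have h2 := congrArg norm h1
    rw [norm_pow, norm_pow, Complex.norm_real, Real.norm_of_nonneg hr.le] at h2
    nlinarith [norm_nonneg (z₀ - a)]
  have hPn : 0 < ‖P z₀‖ ^ 6 := by positivity
  have hgap : 0 < r - ‖z₀ - a‖ := by linarith
  have hpi := Real.pi_pos
  set k : ℝ := (2 * r ^ 2) ^ 6 * (16 / 9) with hk
  refine ⟨r / (r - ‖z₀ - a‖) * (2 * k) / (2 * Real.pi * ‖P z₀‖ ^ 6), by positivity,
    fun g hgm hg hsymm Q hQ0 hQ => ?_⟩
  have hPd : Differentiable ℂ P := by fun_prop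
  have hF : DifferentiableOn ℂ (fun z => (P z ^ 3 * g z) ^ 2) D :=
    ((hPd.differentiableOn.pow 3).mul hg).pow 2
  have h1 := norm_le_integral_circle hF hr hDball (w := z₀) (by simpa [dist_eq_norm] using hz)
  have hnorm : ∀ θ, ‖(P (circleMap a r θ) ^ 3 * g (circleMap a r θ)) ^ 2‖ =
      k * (9 / 16 * Real.sin θ ^ 6 * ‖g (circleMap a r θ)‖ ^ 2) := by
    intro θ
    rw [norm_pow, norm_mul, norm_pow]
    simp only [hP]
    rw [norm_circle_polynomial, hk]
    have : |Real.sin θ| ^ 6 = Real.sin θ ^ 6 := by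
      rw [show 6 = 2 * 3 by norm_num, pow_mul, sq_abs, pow_mul]
    linear_combination (2 * r ^ 2) ^ 6 * ‖g (circleMap a r θ)‖ ^ 2 * this
  set u : ℝ → ℝ := fun θ => 9 / 16 * Real.sin θ ^ 6 * ‖g (circleMap a r θ)‖ ^ 2 with hu
  have hcont : Continuous u := by
    have := hg.continuousOn.comp_continuous (continuous_circleMap a r)
      fun θ => hDball (circleMap_mem_closedBall (a : ℂ) hr.le θ)
    exact (continuous_const.mul (Real.continuous_sin.pow 6)).mul (this.norm.pow 2)
  have hu0 : ∀ θ, 0 ≤ u θ := fun θ => by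
    have : 0 ≤ Real.sin θ ^ 6 := by
      rw [show 6 = 2 * 3 by norm_num, pow_mul]; positivity
    simp only [hu]; positivity
  have hhalf : ∫ θ in (0 : ℝ)..Real.pi, u θ ≤ Q := by
    have h2 := lintegral_halfCircle_le hr hgm hQ
    rw [← ofReal_integral_eq_lintegral_ofReal
      ((hcont.integrableOn_Icc).mono_set Set.Ioo_subset_Icc_self)
      (Filter.Eventually.of_forall hu0), ENNReal.ofReal_le_ofReal_iff hQ0] at h2
    rwa [intervalIntegral.integral_of_le hpi.le, integral_Ioc_eq_integral_Ioo]
  have heven : ∀ θ, u (-θ) = u θ := fun θ => by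
    have h2 : circleMap a r (-θ) = conj (circleMap a r θ) := by
      simp [circleMap, ← Complex.exp_conj]
    simp only [hu]
    rw [h2, hsymm _ (hDball (circleMap_mem_closedBall (a : ℂ) hr.le θ)), Real.sin_neg]
    ring
  have hneg : ∫ θ in -Real.pi..0, u θ = ∫ θ in (0 : ℝ)..Real.pi, u θ := by
    have := intervalIntegral.integral_comp_neg (a := 0) (b := Real.pi) u
    simp_rw [heven] at this
    rw [this, neg_zero]
  have htot : ∫ θ in -Real.pi..Real.pi, u θ ≤ 2 * Q := by
    rw [← intervalIntegral.integral_add_adjacent_intervals (hcont.intervalIntegrable (-Real.pi) 0)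
      (hcont.intervalIntegrable 0 Real.pi), hneg]
    linarith
  simp_rw [hnorm] at h1
  rw [intervalIntegral.integral_const_mul] at h1
  have h3 : r / (r - ‖z₀ - a‖) * (k * ∫ θ in -Real.pi..Real.pi, u θ) ≤
      r / (r - ‖z₀ - a‖) * (k * (2 * Q)) := by gcongr
  have h4 := h1.trans h3
  rw [norm_pow, norm_mul, norm_pow] at h4
  rw [div_mul_eq_mul_div, le_div_iff₀ (by positivity)]
  linarith

end RealCenter

/-! ### Point evaluation when the center is not real -/

section NonrealCenter

open scoped ENNReal

lemma det_complex (A : ℂ →L[ℝ] ℂ) :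
    A.det = (A 1).re * (A Complex.I).im - (A Complex.I).re * (A 1).im := by
  rw [ContinuousLinearMap.det, ← LinearMap.det_toMatrix Complex.basisOneI, Matrix.det_fin_two]
  simp [LinearMap.toMatrix_apply]

/-- Inverse of `discParam a b r` on the upper half plane. -/
noncomputable def discCoord (a b r : ℝ) (z : ℂ) : ℂ :=
  ⟨(z.re - a) / r, (z.im ^ 2 + (z.re - a) ^ 2 - b ^ 2 - r ^ 2) / (2 * b * r)⟩

lemma discCoord_eq (a b r : ℝ) : discCoord a b r = fun z => (((z.re - a) / r : ℝ) : ℂ) +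
    (((z.im ^ 2 + (z.re - a) ^ 2 - b ^ 2 - r ^ 2) / (2 * b * r) : ℝ) : ℂ) * Complex.I := by
  ext z; exact Complex.mk_eq_add_mul_I _ _

lemma continuous_discCoord (a b r : ℝ) : Continuous (discCoord a b r) := by
  rw [discCoord_eq]
  fun_prop

variable {a b r : ℝ}

lemma norm_sq_discCoord (z : ℂ) : ‖discCoord a b r z‖ ^ 2 = ((z.re - a) / r) ^ 2 +
    ((z.im ^ 2 + (z.re - a) ^ 2 - b ^ 2 - r ^ 2) / (2 * b * r)) ^ 2 := by
  rw [← Complex.normSq_eq_norm_sq, Complex.normSq_apply, discCoord]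
  ring

lemma norm_sub_mk_sq (z : ℂ) (a b : ℝ) :
    ‖z - ⟨a, b⟩‖ ^ 2 = (z.re - a) ^ 2 + (z.im - b) ^ 2 := by
  rw [← Complex.normSq_eq_norm_sq, Complex.normSq_apply, Complex.sub_re, Complex.sub_im]
  ring

/-- This factorization shows where the weight lives: in the upper half plane it is positive exactly
inside the circle about a + ib and outside its conjugate. -/
lemma one_sub_norm_sq_discCoord (hb : 0 < b) (hr : 0 < r) (z : ℂ) :
    1 - ‖discCoord a b r z‖ ^ 2 =
      (r ^ 2 - ‖z - ⟨a, b⟩‖ ^ 2) * (‖z - ⟨a, -b⟩‖ ^ 2 - r ^ 2) / (4 * b ^ 2 * r ^ 2) := by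
  rw [norm_sq_discCoord, norm_sub_mk_sq, norm_sub_mk_sq]
  field_simp
  ring

lemma discParam_discCoord (hb : 0 < b) (hr : 0 < r) {z : ℂ} (hz : 0 ≤ z.im) :
    discParam a b r (discCoord a b r z) = z := by
  have h1 : (b + r * (discCoord a b r z).im) ^ 2 + r ^ 2 * (1 - ‖discCoord a b r z‖ ^ 2) =
      z.im ^ 2 := by
    rw [norm_sq_discCoord, discCoord]
    field_simp
    ring
  refine Complex.ext ?_ ?_
  · simp only [discParam, discCoord]
    field_simp
    ring
  · rw [discParam, h1]
    exact Real.sqrt_sq hz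

lemma exists_hasFDerivAt_discCoord (hb : 0 < b) (hr : 0 < r) (z : ℂ) :
    ∃ A : ℂ →L[ℝ] ℂ, HasFDerivAt (discCoord a b r) A z ∧ A.det = z.im / (b * r ^ 2) := by
  have hre : HasFDerivAt (fun z : ℂ => z.re) Complex.reCLM z := Complex.reCLM.hasFDerivAt
  have him : HasFDerivAt (fun z : ℂ => z.im) Complex.imCLM z := Complex.imCLM.hasFDerivAt
  have h1 := (hre.sub_const a).mul_const r⁻¹
  have h2 := ((((him.pow 2).add ((hre.sub_const a).pow 2)).sub_const (b ^ 2)).sub_const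
    (r ^ 2)).mul_const (2 * b * r)⁻¹
  have h3 : HasFDerivAt (𝕜 := ℝ) (fun z : ℂ => (((z.re - a) * r⁻¹ : ℝ) : ℂ)) _ z :=
    Complex.ofRealCLM.hasFDerivAt.comp z h1
  have h5 : HasFDerivAt (𝕜 := ℝ) (fun z : ℂ =>
      (((z.im ^ 2 + (z.re - a) ^ 2 - b ^ 2 - r ^ 2) * (2 * b * r)⁻¹ : ℝ) : ℂ)) _ z :=
    Complex.ofRealCLM.hasFDerivAt.comp z h2
  rw [discCoord_eq]
  simp only [div_eq_mul_inv]
  refine ⟨_, h3.add (h5.mul_const Complex.I), ?_⟩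
  rw [det_complex]
  simp
  field_simp

/-- Change of variables by `discCoord`, whose Jacobian is Im z / (br²). -/
lemma lintegral_upper_le {Q : ℝ} (hb : 0 < b) (hr : 0 < r) {g : ℂ → ℂ} {E : Set ℂ}
    (hE : MeasurableSet E) (hE1 : ∀ z ∈ E, 0 < z.im) (hE2 : ∀ z ∈ E, ‖discCoord a b r z‖ < 1)
    (hQ : ∫⁻ v in ball (0 : ℂ) 1, ENNReal.ofReal ((1 - ‖v‖ ^ 2) ^ 2 *
      ‖g (discParam a b r v)‖ ^ 2) ≤ ENNReal.ofReal Q) :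
    ∫⁻ z in E, ENNReal.ofReal (z.im / (b * r ^ 2) * (1 - ‖discCoord a b r z‖ ^ 2) ^ 2 *
      ‖g z‖ ^ 2) ≤ ENNReal.ofReal Q := by
  choose A hA hAdet using fun z => exists_hasFDerivAt_discCoord (a := a) hb hr z
  have hinj : Set.InjOn (discCoord a b r) E := fun z hz w hw h => by
    rw [← discParam_discCoord (a := a) hb hr (hE1 z hz).le, h,
      discParam_discCoord hb hr (hE1 w hw).le]
  have hcov := lintegral_image_eq_lintegral_abs_det_fderiv_mul volume hE
    (fun z _ => (hA z).hasFDerivWithinAt) hinj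
    (fun v => ENNReal.ofReal ((1 - ‖v‖ ^ 2) ^ 2 * ‖g (discParam a b r v)‖ ^ 2))
  have himg : discCoord a b r '' E ⊆ ball 0 1 := by
    rintro _ ⟨z, hz, rfl⟩
    simpa using hE2 z hz
  refine le_trans (le_of_eq ?_) ((lintegral_mono_set himg).trans hQ)
  rw [hcov]
  refine setLIntegral_congr_fun hE fun z hz => ?_
  have h0 : 0 ≤ z.im / (b * r ^ 2) := div_nonneg (hE1 z hz).le (by positivity)
  rw [hAdet, abs_of_nonneg h0, ← ENNReal.ofReal_mul h0,
    discParam_discCoord hb hr (hE1 z hz).le, mul_assoc]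

lemma sq_norm_mul_le_of_ball {Q ε m : ℝ} (hb : 0 < b) (hr : 0 < r) {g : ℂ → ℂ} {D : Set ℂ} {w : ℂ}
    (hgm : Measurable g) (hg : DifferentiableOn ℂ g D) (hε : 0 < ε) (hw : closedBall w ε ⊆ D)
    (hm0 : 0 ≤ m) (h1 : ∀ z ∈ ball w ε, 0 < z.im) (h2 : ∀ z ∈ ball w ε, ‖discCoord a b r z‖ < 1)
    (hm : ∀ z ∈ ball w ε, m ≤ z.im / (b * r ^ 2) * (1 - ‖discCoord a b r z‖ ^ 2) ^ 2)
    (hQ0 : 0 ≤ Q) (hQ : ∫⁻ v in ball (0 : ℂ) 1, ENNReal.ofReal ((1 - ‖v‖ ^ 2) ^ 2 *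
      ‖g (discParam a b r v)‖ ^ 2) ≤ ENNReal.ofReal Q) :
    m * (Real.pi * ε ^ 2 * ‖g w‖ ^ 2) ≤ Q := by
  rw [← ENNReal.ofReal_le_ofReal_iff hQ0, ENNReal.ofReal_mul hm0]
  calc ENNReal.ofReal m * ENNReal.ofReal (Real.pi * ε ^ 2 * ‖g w‖ ^ 2)
      ≤ ENNReal.ofReal m * ∫⁻ z in ball w ε, ENNReal.ofReal (‖g z‖ ^ 2) :=
        mul_le_mul' le_rfl (sq_norm_le_lintegral_ball hgm hg hε hw)
    _ = ∫⁻ z in ball w ε, ENNReal.ofReal (m * ‖g z‖ ^ 2) := by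
        rw [← lintegral_const_mul' _ _ ENNReal.ofReal_ne_top]
        simp_rw [ENNReal.ofReal_mul hm0]
    _ ≤ ∫⁻ z in ball w ε, ENNReal.ofReal (z.im / (b * r ^ 2) *
          (1 - ‖discCoord a b r z‖ ^ 2) ^ 2 * ‖g z‖ ^ 2) := by
        refine setLIntegral_mono' measurableSet_ball fun z hz => ENNReal.ofReal_le_ofReal ?_
        exact mul_le_mul_of_nonneg_right (hm z hz) (by positivity)
    _ ≤ ENNReal.ofReal Q := lintegral_upper_le hb hr measurableSet_ball h1 h2 hQ

/-- The weight exceeds half its value at z₀ on a small disc, where the mean value inequality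
applies. -/
lemma sq_norm_le_of_upper (hb : 0 < b) (hr : 0 < r) {D : Set ℂ} (hD : IsOpen D) {z₀ : ℂ}
    (hz₀ : z₀ ∈ D) (him : 0 < z₀.im) (hz : ‖discCoord a b r z₀‖ < 1) :
    ∃ K : ℝ, 0 ≤ K ∧ ∀ g : ℂ → ℂ, Measurable g → DifferentiableOn ℂ g D → ∀ Q : ℝ, 0 ≤ Q →
      ∫⁻ v in ball (0 : ℂ) 1, ENNReal.ofReal ((1 - ‖v‖ ^ 2) ^ 2 *
        ‖g (discParam a b r v)‖ ^ 2) ≤ ENNReal.ofReal Q →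
      ‖g z₀‖ ^ 2 ≤ K * Q := by
  set φ : ℂ → ℝ := fun z => z.im / (b * r ^ 2) * (1 - ‖discCoord a b r z‖ ^ 2) ^ 2 with hφ
  have hcV := continuous_discCoord a b r
  have hφc : Continuous φ := by
    have := Complex.continuous_im
    fun_prop
  have hφ0 : 0 < φ z₀ := by
    have : 0 < 1 - ‖discCoord a b r z₀‖ ^ 2 := by
      nlinarith [norm_nonneg (discCoord a b r z₀)]
    simp only [hφ]; positivity
  have hnhds : ∀ᶠ z in nhds z₀, z ∈ D ∧ 0 < z.im ∧ ‖discCoord a b r z‖ < 1 ∧ φ z₀ / 2 < φ z := by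
    filter_upwards [hD.mem_nhds hz₀, (isOpen_lt continuous_const Complex.continuous_im).mem_nhds him,
      (isOpen_lt hcV.norm continuous_const).mem_nhds hz,
      (isOpen_lt continuous_const hφc).mem_nhds (half_lt_self hφ0)] with z h1 h2 h3 h4
    exact ⟨h1, h2, h3, h4⟩
  obtain ⟨δ, hδ, hball⟩ := Metric.eventually_nhds_iff_ball.1 hnhds
  have hsub : ball z₀ (δ / 2) ⊆ ball z₀ δ := ball_subset_ball (by linarith)
  have hpi := Real.pi_pos
  refine ⟨(φ z₀ / 2 * (Real.pi * (δ / 2) ^ 2))⁻¹, by positivity, fun g hgm hg Q hQ0 hQ => ?_⟩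
  have h1 := sq_norm_mul_le_of_ball (m := φ z₀ / 2) hb hr hgm hg (half_pos hδ)
    (fun z hz => (hball z (closedBall_subset_ball (by linarith) hz)).1) (by positivity)
    (fun z hz => (hball z (hsub hz)).2.1) (fun z hz => (hball z (hsub hz)).2.2.1)
    (fun z hz => (hball z (hsub hz)).2.2.2.le) hQ0 hQ
  rw [inv_mul_eq_div, le_div_iff₀ (by positivity)]
  linarith

/-- At w, with y = Im w, both r² - |w - (a + ib)|² and |w - (a - ib)|² - r² equal 2by. On the disc
of radius ε = by/(6r) each stays at least by and Im z ≥ y/2, so the weight is at least y⁵/(32br⁶).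
Multiplied by the area πε² this gives the power y⁷ and the constant 1152 = 32 · 36. -/
lemma circle_pointwise_estimate (hb : 0 < b) (hbr : b < r) {D : Set ℂ}
    (hDball : closedBall (⟨a, b⟩ : ℂ) r ⊆ D) {w : ℂ} (hw : ‖w - a‖ ^ 2 = r ^ 2 - b ^ 2)
    (him : 0 < w.im) {g : ℂ → ℂ} (hgm : Measurable g) (hg : DifferentiableOn ℂ g D) {Q : ℝ}
    (hQ0 : 0 ≤ Q) (hQ : ∫⁻ v in ball (0 : ℂ) 1, ENNReal.ofReal ((1 - ‖v‖ ^ 2) ^ 2 *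
      ‖g (discParam a b r v)‖ ^ 2) ≤ ENNReal.ofReal Q) :
    w.im ^ 7 * ‖g w‖ ^ 2 ≤ 1152 * r ^ 8 / (Real.pi * b) * Q := by
  have hr : 0 < r := hb.trans hbr
  have hpi := Real.pi_pos
  set y := w.im with hy
  set ε := b * y / (6 * r) with hε
  have hε0 : 0 < ε := by positivity
  have hεr : 6 * r * ε = b * y := by rw [hε]; field_simp
  have hw' : (w.re - a) ^ 2 + y ^ 2 = r ^ 2 - b ^ 2 := by
    have := norm_sub_mk_sq w a 0
    rw [sub_zero] at this
    rw [← hw, ← this]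
    rfl
  have hyr : y ≤ r := by nlinarith [sq_nonneg (w.re - a)]
  have hεy : 6 * ε ≤ y := by nlinarith
  have hp : ‖w - ⟨a, b⟩‖ ^ 2 = r ^ 2 - 2 * b * y := by
    rw [norm_sub_mk_sq]; linarith
  have hm : ‖w - ⟨a, -b⟩‖ ^ 2 = r ^ 2 + 2 * b * y := by
    rw [norm_sub_mk_sq]; linarith
  have hpr : ‖w - ⟨a, b⟩‖ ≤ r := by
    refine le_of_sq_le_sq ?_ hr.le
    rw [hp]; nlinarith
  have hmr : ‖w - ⟨a, -b⟩‖ ≤ 3 * r := by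
    refine le_of_sq_le_sq ?_ (by positivity)
    rw [hm]; nlinarith
  have hplus : ∀ z, ‖z - w‖ ≤ ε → b * y ≤ r ^ 2 - ‖z - ⟨a, b⟩‖ ^ 2 := by
    intro z hz
    have h1 : ‖z - ⟨a, b⟩‖ ≤ ‖w - ⟨a, b⟩‖ + ε := by
      have := norm_add_le (z - w) (w - ⟨a, b⟩)
      rw [sub_add_sub_cancel] at this
      linarith
    have h2 := mul_self_le_mul_self (norm_nonneg _) h1
    have h3 : ‖w - ⟨a, b⟩‖ * ε ≤ r * ε := by gcongr
    have h4 : ε * ε ≤ r * ε := by gcongr; linarith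
    nlinarith
  have hminus : ∀ z, ‖z - w‖ ≤ ε → b * y ≤ ‖z - ⟨a, -b⟩‖ ^ 2 - r ^ 2 := by
    intro z hz
    have h1 : ‖w - ⟨a, -b⟩‖ - ε ≤ ‖z - ⟨a, -b⟩‖ := by
      have := norm_add_le (w - z) (z - ⟨a, -b⟩)
      rw [sub_add_sub_cancel, norm_sub_rev w z] at this
      linarith
    have h0 : 0 ≤ ‖w - ⟨a, -b⟩‖ - ε := by
      have h5 : r ≤ ‖w - ⟨a, -b⟩‖ := by
        refine le_of_sq_le_sq ?_ (norm_nonneg _)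
        rw [hm]; nlinarith [mul_pos hb him]
      linarith
    have h2 := mul_self_le_mul_self h0 h1
    have h3 : ‖w - ⟨a, -b⟩‖ * ε ≤ 3 * r * ε := by gcongr
    nlinarith
  have hball : ∀ z ∈ ball w ε, ‖z - w‖ ≤ ε := fun z hz => by
    rw [mem_ball, dist_eq_norm] at hz; exact hz.le
  have hyz : ∀ z, ‖z - w‖ ≤ ε → y / 2 ≤ z.im := fun z hz => by
    have h1 := (Complex.abs_im_le_norm (z - w)).trans hz
    rw [Complex.sub_im] at h1
    have h2 := (abs_le.1 h1).1
    linarith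
  have hw1 : ∀ z, ‖z - w‖ ≤ ε → y ^ 2 / (4 * r ^ 2) ≤ 1 - ‖discCoord a b r z‖ ^ 2 := by
    intro z hz
    rw [one_sub_norm_sq_discCoord hb hr, div_le_div_iff₀ (by positivity) (by positivity)]
    have h1 : (b * y) * (b * y) ≤
        (r ^ 2 - ‖z - ⟨a, b⟩‖ ^ 2) * (‖z - ⟨a, -b⟩‖ ^ 2 - r ^ 2) :=
      mul_le_mul (hplus z hz) (hminus z hz) (by positivity)
        ((by positivity : (0 : ℝ) ≤ b * y).trans (hplus z hz))
    have h2 : (b * y) * (b * y) * (4 * r ^ 2) ≤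
        (r ^ 2 - ‖z - ⟨a, b⟩‖ ^ 2) * (‖z - ⟨a, -b⟩‖ ^ 2 - r ^ 2) * (4 * r ^ 2) := by gcongr
    linarith
  have key := sq_norm_mul_le_of_ball (m := y / 2 / (b * r ^ 2) * (y ^ 2 / (4 * r ^ 2)) ^ 2)
    hb hr hgm hg hε0 (w := w)
    (fun z hz => hDball (by
      rw [mem_closedBall, dist_eq_norm] at hz
      have h1 := hplus z hz
      rw [mem_closedBall, dist_eq_norm]
      refine le_of_sq_le_sq ?_ hr.le
      linarith [mul_pos hb him]))
    (by positivity) (fun z hz => (half_pos him).trans_le (hyz z (hball z hz)))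
    (fun z hz => by
      have h1 := hw1 z (hball z hz)
      have h2 : 0 < y ^ 2 / (4 * r ^ 2) := by positivity
      rw [← sq_lt_one_iff₀ (norm_nonneg _)]
      linarith)
    (fun z hz => by
      have h1 := hw1 z (hball z hz)
      have h2 := hyz z (hball z hz)
      have h3 : 0 ≤ z.im / (b * r ^ 2) := div_nonneg ((half_pos him).le.trans h2) (by positivity)
      gcongr) hQ0 hQ
  have h5 : y / 2 / (b * r ^ 2) * (y ^ 2 / (4 * r ^ 2)) ^ 2 * (Real.pi * ε ^ 2 * ‖g w‖ ^ 2) =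
      (y ^ 7 * ‖g w‖ ^ 2) * (Real.pi * b / (1152 * r ^ 8)) := by
    rw [hε]; field_simp; norm_num; ring
  rw [h5] at key
  rw [div_mul_eq_mul_div, le_div_iff₀ (by positivity)]
  rw [← mul_div_assoc, div_le_iff₀ (by positivity)] at key
  linarith

/-- The maximum principle for (P⁴g)² on the disc of center a and radius s = √(r² - b²), where P = (z
- a)² - s². On its boundary |P| = 2s|Im w|, so |P|⁸ absorbs the blow-up |Im w|⁻⁷ of the pointwise
estimate. -/
lemma sq_norm_le_of_lens (hb : 0 < b) (hbr : b < r) {D : Set ℂ} (hDsymm : IsSymmetricSet D)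
    (hDball : closedBall (⟨a, b⟩ : ℂ) r ⊆ D) {z₀ : ℂ} (hz : ‖z₀ - a‖ ^ 2 < r ^ 2 - b ^ 2) :
    ∃ K : ℝ, 0 ≤ K ∧ ∀ g : ℂ → ℂ, Measurable g → DifferentiableOn ℂ g D →
      (∀ z ∈ D, ‖g (conj z)‖ = ‖g z‖) → ∀ Q : ℝ, 0 ≤ Q →
      ∫⁻ v in ball (0 : ℂ) 1, ENNReal.ofReal ((1 - ‖v‖ ^ 2) ^ 2 *
        ‖g (discParam a b r v)‖ ^ 2) ≤ ENNReal.ofReal Q →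
      ‖g z₀‖ ^ 2 ≤ K * Q := by
  have hr : 0 < r := hb.trans hbr
  have hpi := Real.pi_pos
  set s := Real.sqrt (r ^ 2 - b ^ 2) with hs
  have hpos : 0 < r ^ 2 - b ^ 2 := by nlinarith
  have hs0 : 0 < s := Real.sqrt_pos.2 hpos
  have hs2 : s ^ 2 = r ^ 2 - b ^ 2 := Real.sq_sqrt hpos.le
  have hnorm : ∀ z : ℂ, ‖z - a‖ ^ 2 = (z.re - a) ^ 2 + z.im ^ 2 := fun z => by
    have := norm_sub_mk_sq z a 0
    rwa [sub_zero] at this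
  have hballD : closedBall (a : ℂ) s ⊆ D := by
    have hup : ∀ z : ℂ, ‖z - a‖ ≤ s → 0 ≤ z.im → z ∈ D := fun z hz him => by
      refine hDball ?_
      rw [mem_closedBall, dist_eq_norm]
      refine le_of_sq_le_sq ?_ hr.le
      have h1 : ‖z - a‖ ^ 2 ≤ s ^ 2 := by gcongr
      rw [norm_sub_mk_sq]
      rw [hnorm] at h1
      nlinarith [mul_nonneg hb.le him]
    intro z hz
    rw [mem_closedBall, dist_eq_norm] at hz
    rcases le_total 0 z.im with h | h
    · exact hup z hz h
    · have h1 : conj z ∈ D := by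
        refine hup _ ?_ (by simpa using h)
        rw [← Complex.norm_conj]
        simpa using hz
      simpa using hDsymm _ h1
  set P : ℂ → ℂ := fun z => (z - a) ^ 2 - (s : ℂ) ^ 2 with hP
  have hP0 : P z₀ ≠ 0 := fun h => by
    have h1 : (z₀ - a) ^ 2 = (s : ℂ) ^ 2 := sub_eq_zero.1 h
    have h2 := congrArg norm h1
    rw [norm_pow, norm_pow, Complex.norm_real, Real.norm_of_nonneg hs0.le] at h2
    linarith
  set k := (2 * s) ^ 8 * s * (1152 * r ^ 8 / (Real.pi * b)) with hk
  have hk0 : 0 ≤ k := by positivity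
  refine ⟨k / ‖P z₀‖ ^ 8, by positivity, fun g hgm hg hsymm Q hQ0 hQ => ?_⟩
  have hPd : Differentiable ℂ P := by fun_prop
  have hF : DifferentiableOn ℂ (fun z => (P z ^ 4 * g z) ^ 2) D :=
    ((hPd.differentiableOn.pow 4).mul hg).pow 2
  have hbd : ∀ θ, ‖(P (circleMap a s θ) ^ 4 * g (circleMap a s θ)) ^ 2‖ ≤ k * Q := by
    intro θ
    set w := circleMap a s θ with hw
    have hwn : ‖w - a‖ = s := by
      have := circleMap_mem_sphere (a : ℂ) hs0.le θ
      rwa [mem_sphere, dist_eq_norm] at this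
    have hwD : w ∈ D := hballD (circleMap_mem_closedBall (a : ℂ) hs0.le θ)
    have hwim : w.im = s * Real.sin θ := by
      rw [hw, circleMap, Complex.exp_mul_I, ← Complex.ofReal_cos, ← Complex.ofReal_sin]
      simp only [Complex.add_im, Complex.ofReal_im, Complex.mul_im, Complex.ofReal_re,
        Complex.add_re, Complex.mul_re, Complex.I_re, Complex.I_im]
      ring
    have hPw : ‖P w‖ = 2 * s * |w.im| := by
      have h1 : ‖P w‖ = 2 * s ^ 2 * |Real.sin θ| := norm_circle_polynomial a s θ
      rw [h1, hwim, abs_mul, abs_of_pos hs0]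
      ring
    have hmain : |w.im| ^ 7 * ‖g w‖ ^ 2 ≤ 1152 * r ^ 8 / (Real.pi * b) * Q := by
      rcases lt_trichotomy 0 w.im with h | h | h
      · rw [abs_of_pos h]
        exact circle_pointwise_estimate hb hbr hDball (by rw [hwn, hs2]) h hgm hg hQ0 hQ
      · rw [← h, abs_zero, zero_pow (by norm_num), zero_mul]
        positivity
      · have h1 : ‖conj w - a‖ ^ 2 = r ^ 2 - b ^ 2 := by
          rw [← Complex.norm_conj, ← hs2, ← hwn]
          simp
        have h2 := circle_pointwise_estimate hb hbr hDball h1 (by simpa using h) hgm hg hQ0 hQ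
        rw [hsymm w hwD, Complex.conj_im] at h2
        rwa [abs_of_neg h]
    have him : |w.im| ≤ s := by
      have h1 := Complex.abs_im_le_norm (w - a)
      rw [hwn] at h1
      simpa using h1
    -- Seven of the eight powers of |Im w| are used; the spare one is bounded by s.
    rw [norm_pow, norm_mul, norm_pow, hPw]
    calc ((2 * s * |w.im|) ^ 4 * ‖g w‖) ^ 2
        = (2 * s) ^ 8 * |w.im| * (|w.im| ^ 7 * ‖g w‖ ^ 2) := by ring
      _ ≤ (2 * s) ^ 8 * s * (1152 * r ^ 8 / (Real.pi * b) * Q) := by gcongr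
      _ = k * Q := by rw [hk]; ring
  have hmax := Complex.norm_le_of_forall_mem_frontier_norm_le (U := ball (a : ℂ) s)
    (f := fun z => (P z ^ 4 * g z) ^ 2) isBounded_ball
    ((hF.mono hballD).diffContOnCl_ball subset_rfl) (C := k * Q)
    (fun z hz => by
      rw [frontier_ball _ hs0.ne', ← abs_of_pos hs0, ← range_circleMap] at hz
      obtain ⟨θ, rfl⟩ := hz
      exact hbd θ)
    (subset_closure (show z₀ ∈ ball (a : ℂ) s by
      rw [mem_ball, dist_eq_norm]
      exact lt_of_pow_lt_pow_left₀ 2 hs0.le (by rwa [hs2])))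
  have hPn : 0 < ‖P z₀‖ ^ 8 := by positivity
  simp only [norm_pow, norm_mul] at hmax
  rw [div_mul_eq_mul_div, le_div_iff₀ hPn]
  linarith

end NonrealCenter

/-- A holomorphic function with a symmetric modulus is controlled, at the points whose quaternionic
circle lies in the ball of center `a + b J` and radius `r`, by its weighted `L²` norm in the disc
coordinates of the sphere. -/
theorem exists_sq_norm_le_of_lintegral_disc_le {a b r : ℝ} (hb : 0 ≤ b) (hr : 0 < r) {D : Set ℂ}
    (hD : IsOpen D) (hDsymm : IsSymmetricSet D) (hDball : closedBall (⟨a, b⟩ : ℂ) r ⊆ D)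
    {z₀ : ℂ} (hz : ‖z₀ - ⟨a, b⟩‖ < r) :
    ∃ K : ℝ, 0 ≤ K ∧ ∀ g : ℂ → ℂ, Measurable g → DifferentiableOn ℂ g D →
      (∀ z ∈ D, ‖g (conj z)‖ = ‖g z‖) → ∀ Q : ℝ, 0 ≤ Q →
      ∫⁻ v in ball (0 : ℂ) 1, ENNReal.ofReal ((1 - ‖v‖ ^ 2) ^ 2 *
        ‖g (discParam a b r v)‖ ^ 2) ≤ ENNReal.ofReal Q →
      ‖g z₀‖ ^ 2 ≤ K * Q := by
  rcases hb.eq_or_lt with rfl | hb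
  · exact sq_norm_le_of_real_center hr hDball hz
  have hz2 : ‖z₀ - ⟨a, b⟩‖ ^ 2 < r ^ 2 := by gcongr
  -- Outside the conjugate disc z₀ is in the image of the disc coordinates. Otherwise, adding the
  -- two disc inequalities gives |z₀ - a|² + b² < r², which also forces b < r.
  by_cases h : r ^ 2 < ‖z₀ - ⟨a, -b⟩‖ ^ 2
  · have him : 0 < z₀.im := by
      rw [norm_sub_mk_sq] at h hz2
      have : 0 < b * z₀.im := by linarith
      exact (mul_pos_iff_of_pos_left hb).1 this
    have hdisc : ‖discCoord a b r z₀‖ < 1 := by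
      rw [← sq_lt_one_iff₀ (norm_nonneg _), ← sub_pos, one_sub_norm_sq_discCoord hb hr]
      exact div_pos (mul_pos (sub_pos.2 hz2) (sub_pos.2 h)) (by positivity)
    obtain ⟨K, hK, H⟩ := sq_norm_le_of_upper hb hr hD
      (hDball (by rw [mem_closedBall, dist_eq_norm]; exact hz.le)) him hdisc
    exact ⟨K, hK, fun g hgm hg _ => H g hgm hg⟩
  · have hlens : ‖z₀ - a‖ ^ 2 < r ^ 2 - b ^ 2 := by
      have h1 := norm_sub_mk_sq z₀ a 0
      rw [sub_zero] at h1
      rw [show (a : ℂ) = ⟨a, 0⟩ from rfl, h1]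
      rw [norm_sub_mk_sq] at h hz2
      linarith
    have hbr : b < r := by
      refine lt_of_pow_lt_pow_left₀ 2 hr.le ?_
      linarith [sq_nonneg ‖z₀ - a‖]
    exact sq_norm_le_of_lens hb hbr hDsymm hDball hlens

/-! ### Regular functions and their stem functions -/

section Stem

variable {D : Set ℂ} {F₁ F₂ G₁ G₂ : ℂ → ℍ} {f g : ℍ → ℍ}

lemma IsStemFunction.add (hF : IsStemFunction D F₁ F₂) (hG : IsStemFunction D G₁ G₂) :
    IsStemFunction D (F₁ + G₁) (F₂ + G₂) := fun z hz => by
  obtain ⟨h1, h2⟩ := hF z hz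
  obtain ⟨h3, h4⟩ := hG z hz
  simp only [Pi.add_apply]
  rw [h1, h2, h3, h4]
  exact ⟨rfl, by abel⟩

lemma IsHolomorphicStem.add (hF : IsHolomorphicStem D F₁ F₂) (hG : IsHolomorphicStem D G₁ G₂) :
    IsHolomorphicStem D (F₁ + G₁) (F₂ + G₂) := fun z hz => by
  obtain ⟨h1, h2, h3, h4⟩ := hF z hz
  obtain ⟨k1, k2, k3, k4⟩ := hG z hz
  refine ⟨h1.add k1, h2.add k2, ?_, ?_⟩
  · rw [fderiv_add h1 k1, fderiv_add h2 k2]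
    simp only [_root_.add_apply, h3, k3]
  · rw [fderiv_add h1 k1, fderiv_add h2 k2]
    simp only [_root_.add_apply, h4, k4]
    abel

lemma IsSliceRegular.add (hf : IsSliceRegular D f) (hg : IsSliceRegular D g) :
    IsSliceRegular D (f + g) := by
  obtain ⟨F₁, F₂, h1, h2, h3⟩ := hf
  obtain ⟨G₁, G₂, k1, k2, k3⟩ := hg
  refine ⟨F₁ + G₁, F₂ + G₂, h1.add k1, h2.add k2, fun z hz I hI => ?_⟩
  simp only [Pi.add_apply]
  rw [h3 z hz I hI, k3 z hz I hI, mul_add]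
  abel

/-- Regular functions are stable under real linear maps that commute with left multiplications. -/
lemma IsSliceRegular.clm_comp (hf : IsSliceRegular D f) (A : ℍ →L[ℝ] ℍ)
    (hA : ∀ x y, A (x * y) = x * A y) : IsSliceRegular D (fun q => A (f q)) := by
  obtain ⟨F₁, F₂, h1, h2, h3⟩ := hf
  refine ⟨A ∘ F₁, A ∘ F₂, fun z hz => ?_, fun z hz => ?_, fun z hz I hI => ?_⟩
  · obtain ⟨h4, h5⟩ := h1 z hz
    simp only [Function.comp_apply]
    rw [h4, h5, map_neg]
    exact ⟨rfl, rfl⟩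
  · obtain ⟨h4, h5, h6, h7⟩ := h2 z hz
    have e1 := A.hasFDerivAt.comp z h4.hasFDerivAt
    have e2 := A.hasFDerivAt.comp z h5.hasFDerivAt
    refine ⟨e1.differentiableAt, e2.differentiableAt, ?_, ?_⟩
    · rw [e1.fderiv, e2.fderiv]
      simp [h6]
    · rw [e1.fderiv, e2.fderiv]
      simp [h7]
  · change A (f _) = A (F₁ z) + I * A (F₂ z)
    rw [h3 z hz I hI, map_add, hA]

lemma isSliceRegular_zero : IsSliceRegular D (0 : ℍ → ℍ) :=
  ⟨0, 0, fun _ _ => by simp, fun _ _ => by simp, fun _ _ _ _ => by simp⟩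

variable (D) in
/-- The real vector space of regular functions. -/
def sliceRegularSubmodule : Submodule ℝ (ℍ → ℍ) where
  carrier := {f | IsSliceRegular D f}
  add_mem' := IsSliceRegular.add
  zero_mem' := isSliceRegular_zero
  smul_mem' t f hf := hf.clm_comp (t • ContinuousLinearMap.id ℝ ℍ) fun x y => by simp

lemma IsHolomorphicStem.continuousOn (hF : IsHolomorphicStem D F₁ F₂) :
    ContinuousOn F₁ D ∧ ContinuousOn F₂ D :=
  ⟨fun z hz => (hF z hz).1.continuousAt.continuousWithinAt,
    fun z hz => (hF z hz).2.1.continuousAt.continuousWithinAt⟩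

lemma measurable_indicator_of_continuousOn {F : ℂ → ℍ} (hD : IsOpen D) (hF : ContinuousOn F D) :
    Measurable (D.indicator F) := by
  classical
  rw [← Set.piecewise_eq_indicator]
  exact hF.measurable_piecewise continuousOn_const hD.measurableSet

lemma sliceUnit_mul_self {q : ℍ} (hq : q.im ≠ 0) : sliceUnit q * sliceUnit q = -1 := by
  have h1 := Quaternion.im_sq q
  rw [sq, Quaternion.normSq_eq_norm_mul_self] at h1
  have hn : ‖q.im‖ ≠ 0 := by simpa using hq
  rw [sliceUnit, smul_mul_smul_comm, h1, smul_neg, ← Quaternion.coe_smul]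
  congr 1
  rw [smul_eq_mul, show ‖q.im‖⁻¹ * ‖q.im‖⁻¹ * (‖q.im‖ * ‖q.im‖) = 1 by field_simp]
  rfl

lemma im_eq_norm_smul_sliceUnit (q : ℍ) : q.im = ‖q.im‖ • sliceUnit q := by
  by_cases h : q.im = 0
  · simp [h]
  · rw [sliceUnit, smul_inv_smul₀ (by simpa using h)]

lemma exists_imaginaryUnit : ∃ J : ℍ, J * J = -1 := by
  refine ⟨Quaternion.coeComplex Complex.I, ?_⟩
  rw [← Quaternion.coeComplex_mul, Complex.I_mul_I]
  ext <;> simp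

lemma exists_im_eq_norm_smul (q : ℍ) : ∃ J : ℍ, J * J = -1 ∧ q.im = ‖q.im‖ • J := by
  by_cases h : q.im = 0
  · obtain ⟨J, hJ⟩ := exists_imaginaryUnit
    exact ⟨J, hJ, by simp [h]⟩
  · exact ⟨sliceUnit q, sliceUnit_mul_self h, im_eq_norm_smul_sliceUnit q⟩

lemma sliceCoord_mk {J : ℍ} (hJ : J * J = -1) (z : ℂ) :
    sliceCoord ((z.re : ℍ) + J * (z.im : ℍ)) = ⟨z.re, |z.im|⟩ := by
  have h1 : ((z.re : ℍ) + J * (z.im : ℍ)).re = z.re := by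
    rw [Quaternion.mul_coe_eq_smul, Quaternion.re_add, Quaternion.re_smul,
      re_eq_zero_of_mul_self hJ]
    simp
  have h2 : ((z.re : ℍ) + J * (z.im : ℍ)).im = z.im • J := by
    rw [Quaternion.mul_coe_eq_smul, Quaternion.im_add, Quaternion.im_smul,
      im_eq_self_of_mul_self hJ]
    simp
  rw [sliceCoord, h1, h2, norm_smul, norm_eq_one_of_mul_self hJ, mul_one, Real.norm_eq_abs]

lemma sliceCoord_mem (hD : IsSymmetricSet D) {q : ℍ} (hq : q ∈ circularization D) :
    sliceCoord q ∈ D := by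
  obtain ⟨z, hz, J, hJ, rfl⟩ := hq
  rw [sliceCoord_mk hJ]
  rcases le_total 0 z.im with h | h
  · rw [abs_of_nonneg h]; exact hz
  · rw [abs_of_nonpos h]; exact hD z hz

/-- The slice of the ball by ℝ + ℝJ is this disc, which settles its upper half. A point of the lower
half has a conjugate at least as close to the center, and D is symmetric. -/
lemma closedBall_subset_of_circularization (hD : IsSymmetricSet D) {c J : ℍ} {r : ℝ}
    (hJ : J * J = -1) (hc : c.im = ‖c.im‖ • J) (hS : closedBall c r ⊆ circularization D) :
    closedBall (⟨c.re, ‖c.im‖⟩ : ℂ) r ⊆ D := by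
  have hup : ∀ z : ℂ, 0 ≤ z.im → z ∈ closedBall (⟨c.re, ‖c.im‖⟩ : ℂ) r → z ∈ D := by
    intro z him hz
    rw [mem_closedBall, dist_eq_norm] at hz
    have h1 : (z.re : ℍ) + J * (z.im : ℍ) ∈ closedBall c r := by
      rw [mem_closedBall, dist_eq_norm]
      refine le_trans (le_of_eq ?_) hz
      refine (pow_left_inj₀ (norm_nonneg _) (norm_nonneg _) two_ne_zero).1 ?_
      rw [norm_sub_mk_sq]
      have h3 : (z.re : ℍ) + J * (z.im : ℍ) - c = ((z.re - c.re : ℝ) : ℍ) + (z.im - ‖c.im‖) • J := by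
        conv_lhs => rw [← Quaternion.re_add_im c, hc]
        rw [Quaternion.mul_coe_eq_smul, sub_smul, Quaternion.coe_sub]
        abel
      rw [h3, norm_sq_eq_re_im, Quaternion.re_add, Quaternion.im_add, Quaternion.re_smul,
        Quaternion.im_smul, re_eq_zero_of_mul_self hJ, im_eq_self_of_mul_self hJ]
      simp [norm_smul, norm_eq_one_of_mul_self hJ]
    have h2 := sliceCoord_mem hD (hS h1)
    rw [sliceCoord_mk hJ, abs_of_nonneg him] at h2
    exact h2
  intro z hz
  rcases le_total 0 z.im with h | h
  · exact hup z h hz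
  · have h1 : conj z ∈ D := by
      refine hup _ (by simpa using h) ?_
      rw [mem_closedBall, dist_eq_norm] at hz ⊢
      refine le_trans (le_of_sq_le_sq ?_ (norm_nonneg _)) hz
      rw [norm_sub_mk_sq, norm_sub_mk_sq, Complex.conj_re, Complex.conj_im]
      nlinarith [mul_nonneg (norm_nonneg c.im) (neg_nonneg.2 h)]
    simpa using hD _ h1

/-- At a real point F₂ vanishes by oddness, so the convention `sliceUnit q = 0` is harmless. The
indicators make the stem functions measurable on all of ℂ, as nothing is known off D. -/
lemma IsInducedBy.eq_sliceValue (hf : IsInducedBy D f F₁ F₂) (hF : IsStemFunction D F₁ F₂)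
    (hD : IsSymmetricSet D) {q : ℍ} (hq : q ∈ circularization D) :
    f q = sliceValue (D.indicator F₁) (D.indicator F₂) q := by
  have hz := sliceCoord_mem hD hq
  rw [sliceValue, Set.indicator_of_mem hz, Set.indicator_of_mem hz]
  have hre : (sliceCoord q).re = q.re := rfl
  have him : (sliceCoord q).im = ‖q.im‖ := rfl
  obtain ⟨J, hJ, hqJ⟩ := exists_im_eq_norm_smul q
  have h1 := hf _ hz J hJ
  rw [hre, him, Quaternion.mul_coe_eq_smul, ← hqJ, Quaternion.re_add_im] at h1
  rw [h1]
  by_cases h : q.im = 0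
  · have h2 : conj (sliceCoord q) = sliceCoord q := by
      refine Complex.ext rfl ?_
      rw [Complex.conj_im, him, h, norm_zero, neg_zero]
    have h3 := (hF _ hz).2
    rw [h2] at h3
    have h4 : (2 : ℝ) • F₂ (sliceCoord q) = 0 := by
      rw [two_smul]
      nth_rewrite 1 [h3]
      exact neg_add_cancel _
    rw [(smul_eq_zero.1 h4).resolve_left two_ne_zero, mul_zero, mul_zero]
  · have h2 : J = sliceUnit q := by
      have h3 := im_eq_norm_smul_sliceUnit q
      rw [hqJ, norm_smul, norm_norm, norm_eq_one_of_mul_self hJ, mul_one] at h3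
      exact smul_right_injective ℍ (norm_ne_zero_iff.2 h) h3
    rw [h2]

/-- The complex component of a stem function along a real linear form. -/
lemma IsHolomorphicStem.differentiableOn_component (hF : IsHolomorphicStem D F₁ F₂)
    (l : ℍ →L[ℝ] ℝ) :
    DifferentiableOn ℂ (fun z => (l (F₁ z) : ℂ) + (l (F₂ z) : ℂ) * Complex.I) D := by
  intro z hz
  obtain ⟨h1, h2, h3, h4⟩ := hF z hz
  have e1 : HasFDerivAt (𝕜 := ℝ) (fun z => (l (F₁ z) : ℂ)) _ z :=
    (Complex.ofRealCLM.comp l).hasFDerivAt.comp z h1.hasFDerivAt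
  have e2 : HasFDerivAt (𝕜 := ℝ) (fun z => (l (F₂ z) : ℂ)) _ z :=
    (Complex.ofRealCLM.comp l).hasFDerivAt.comp z h2.hasFDerivAt
  have e3 := e1.add (e2.mul_const Complex.I)
  refine DifferentiableAt.differentiableWithinAt ?_
  refine differentiableAt_complex_iff_differentiableAt_real.2 ⟨e3.differentiableAt, ?_⟩
  have e4 := e3.fderiv
  change fderiv ℝ (fun z => (l (F₁ z) : ℂ) + (l (F₂ z) : ℂ) * Complex.I) z = _ at e4
  rw [e4]
  simp [h3, h4]
  linear_combination -(l (fderiv ℝ F₂ z 1) : ℂ) * Complex.I_sq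

end Stem

/-! ### The L² bound for evaluation at an interior point -/

section Main

open scoped ENNReal

variable {D : Set ℂ} {p c : ℍ} {r : ℝ}

/-- The real coordinates of a quaternion. -/
noncomputable def quaternionCoord (k : Fin 4) : ℍ →L[ℝ] ℝ :=
  (EuclideanSpace.proj k : EuclideanSpace ℝ (Fin 4) →L[ℝ] ℝ).comp
    (Quaternion.linearIsometryEquivTuple.toContinuousLinearEquiv :
      ℍ →L[ℝ] EuclideanSpace ℝ (Fin 4))

lemma sum_sq_quaternionCoord (q : ℍ) : ∑ k, quaternionCoord k q ^ 2 = ‖q‖ ^ 2 := by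
  rw [← Quaternion.linearIsometryEquivTuple.norm_map q, EuclideanSpace.norm_sq_eq]
  refine Finset.sum_congr rfl fun k _ => ?_
  rw [Real.norm_eq_abs, sq_abs]
  rfl

/-- Slice coordinates map the sphere onto a compact subset of D, where the stem functions are
continuous. This serves both for membership in L² and for μ-integrability. -/
lemma IsSliceRegular.measurable_and_bounded_on_sphere {f : ℍ → ℍ} (hD : IsOpen D) (hDsymm : IsSymmetricSet D)
    (hS : closedBall c r ⊆ circularization D) (hf : IsSliceRegular D f) :
    Measurable (fun q : sphere c r => f q) ∧ ∃ M : ℝ, ∀ q : sphere c r, ‖f q‖ ≤ M := by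
  obtain ⟨F₁, F₂, h1, h2, h3⟩ := hf
  have hcirc : ∀ q : sphere c r, (q : ℍ) ∈ circularization D := fun q =>
    hS (sphere_subset_closedBall q.2)
  have hval : (fun q : sphere c r => f q) = fun q : sphere c r =>
      sliceValue (D.indicator F₁) (D.indicator F₂) q :=
    funext fun q => h3.eq_sliceValue h1 hDsymm (hcirc q)
  obtain ⟨c1, c2⟩ := h2.continuousOn
  constructor
  · rw [hval]
    exact (measurable_sliceValue (measurable_indicator_of_continuousOn hD c1)
      (measurable_indicator_of_continuousOn hD c2)).comp measurable_subtype_coe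
  · have hK : IsCompact (sliceCoord '' sphere c r) :=
      (isCompact_sphere c r).image continuous_sliceCoord
    have hKD : sliceCoord '' sphere c r ⊆ D := by
      rintro _ ⟨q, hq, rfl⟩
      exact sliceCoord_mem hDsymm (hcirc ⟨q, hq⟩)
    obtain ⟨M₁, hM₁⟩ := hK.exists_bound_of_continuousOn (c1.mono hKD)
    obtain ⟨M₂, hM₂⟩ := hK.exists_bound_of_continuousOn (c2.mono hKD)
    refine ⟨M₁ + M₂, fun q => ?_⟩
    have hq : sliceCoord q ∈ sliceCoord '' sphere c r := ⟨q, q.2, rfl⟩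
    rw [congrFun hval q, sliceValue, Set.indicator_of_mem (hKD hq), Set.indicator_of_mem (hKD hq)]
    refine (norm_add_le _ _).trans (add_le_add (hM₁ _ hq) ?_)
    rw [norm_mul]
    exact (mul_le_of_le_one_left (norm_nonneg _) (norm_sliceUnit_le _)).trans (hM₂ _ hq)

lemma IsSliceRegular.memLp {f : ℍ → ℍ} (hD : IsOpen D) (hDsymm : IsSymmetricSet D)
    (hr : 0 < r) (hS : closedBall c r ⊆ circularization D) (hf : IsSliceRegular D f) :
    MemLp (fun q : sphere c r => f q) 2 (sphereSurfaceMeasure c r hr) := by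
  obtain ⟨hm, M, hM⟩ := IsSliceRegular.measurable_and_bounded_on_sphere hD hDsymm hS hf
  exact MemLp.of_bound hm.aestronglyMeasurable M (Filter.Eventually.of_forall hM)

lemma norm_sliceCoord_sub_lt (hp : p ∈ ball c r) : ‖sliceCoord p - ⟨c.re, ‖c.im‖⟩‖ < r := by
  rw [mem_ball, dist_eq_norm] at hp
  refine lt_of_le_of_lt (le_of_sq_le_sq ?_ (norm_nonneg _)) hp
  rw [norm_sub_mk_sq, norm_sq_eq_re_im, Quaternion.re_sub, Quaternion.im_sub]
  have h1 := abs_norm_sub_norm_le p.im c.im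
  have h2 : (‖p.im‖ - ‖c.im‖) ^ 2 ≤ ‖p.im - c.im‖ ^ 2 := by
    rw [← sq_abs]; gcongr
  exact add_le_add le_rfl h2

/-- The value at an interior point of a ball is bounded on regular functions by the `L²` norm on the
boundary sphere. -/
theorem exists_sq_norm_le_integral_sphere (hD : IsOpen D) (hDsymm : IsSymmetricSet D)
    (hr : 0 < r) (hp : p ∈ ball c r) (hS : closedBall c r ⊆ circularization D) :
    ∃ C : ℝ, ∀ f : ℍ → ℍ, IsSliceRegular D f →
      ‖f p‖ ^ 2 ≤ C * ∫ q : sphere c r, ‖f q‖ ^ 2 ∂(sphereSurfaceMeasure c r hr) := by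
  obtain ⟨J, hJ, hcJ⟩ := exists_im_eq_norm_smul c
  obtain ⟨M, hM, hdisc⟩ := exists_lintegral_disc_le_sphere hJ (norm_nonneg c.im) hr rfl hcJ
  have hball := closedBall_subset_of_circularization hDsymm hJ hcJ hS
  obtain ⟨K, hK, hpt⟩ := exists_sq_norm_le_of_lintegral_disc_le (norm_nonneg c.im) hr hD hDsymm
    hball (norm_sliceCoord_sub_lt hp)
  -- A factor 4 from the real coordinates of ℍ and 2 from (x + y)² ≤ 2(x² + y²).
  refine ⟨8 * K * M, fun f hf => ?_⟩
  have hmem := hf.memLp hD hDsymm hr hS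
  obtain ⟨F₁, F₂, h1, h2, h3⟩ := hf
  obtain ⟨c1, c2⟩ := h2.continuousOn
  have m1 := measurable_indicator_of_continuousOn hD c1
  have m2 := measurable_indicator_of_continuousOn hD c2
  have hpc : p ∈ circularization D := hS (ball_subset_closedBall hp)
  have hzD := sliceCoord_mem hDsymm hpc
  set I := ∫ q : sphere c r, ‖f q‖ ^ 2 ∂(sphereSurfaceMeasure c r hr) with hI
  have hI0 : 0 ≤ I := integral_nonneg fun _ => by positivity
  have hQ : ∫⁻ v in ball (0 : ℂ) 1, ENNReal.ofReal ((1 - ‖v‖ ^ 2) ^ 2 *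
      (‖D.indicator F₁ (discParam c.re ‖c.im‖ r v)‖ ^ 2 +
        ‖D.indicator F₂ (discParam c.re ‖c.im‖ r v)‖ ^ 2)) ≤ ENNReal.ofReal (M * I) := by
    refine (hdisc _ _ m1 m2).trans (le_of_eq ?_)
    rw [ENNReal.ofReal_mul hM.le, hI, ofReal_integral_eq_lintegral_ofReal]
    · congr 1
      refine lintegral_congr fun q => ?_
      rw [h3.eq_sliceValue h1 hDsymm (hS (sphere_subset_closedBall q.2))]
    · exact hmem.integrable_norm_pow two_ne_zero
    · exact Filter.Eventually.of_forall fun _ => by positivity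
  have hnsq : ∀ x y : ℝ, ‖(x : ℂ) + (y : ℂ) * Complex.I‖ ^ 2 = x ^ 2 + y ^ 2 := fun x y => by
    rw [← Complex.normSq_eq_norm_sq, Complex.normSq_add_mul_I]
  have hcomp : ∀ k, quaternionCoord k (F₁ (sliceCoord p)) ^ 2 +
      quaternionCoord k (F₂ (sliceCoord p)) ^ 2 ≤ K * (M * I) := by
    intro k
    set l := quaternionCoord k with hl
    have hlk : ∀ q, l q ^ 2 ≤ ‖q‖ ^ 2 := fun q => by
      rw [← sum_sq_quaternionCoord q]
      exact Finset.single_le_sum (f := fun k => quaternionCoord k q ^ 2)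
        (fun _ _ => sq_nonneg _) (Finset.mem_univ k)
    set g : ℂ → ℂ := fun z => (l (D.indicator F₁ z) : ℂ) + (l (D.indicator F₂ z) : ℂ) * Complex.I
      with hg
    have hgD : ∀ z ∈ D, g z = (l (F₁ z) : ℂ) + (l (F₂ z) : ℂ) * Complex.I := fun z hz => by
      simp only [hg, Set.indicator_of_mem hz]
    have hgm : Measurable g := by
      have e1 := Complex.measurable_ofReal.comp (l.measurable.comp m1)
      have e2 := Complex.measurable_ofReal.comp (l.measurable.comp m2)
      exact e1.add (e2.mul_const Complex.I)
    have hgd : DifferentiableOn ℂ g D := (h2.differentiableOn_component l).congr hgD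
    have hgs : ∀ z ∈ D, ‖g (conj z)‖ = ‖g z‖ := fun z hz => by
      refine (pow_left_inj₀ (norm_nonneg _) (norm_nonneg _) two_ne_zero).1 ?_
      rw [hgD z hz, hgD _ (hDsymm z hz), hnsq, hnsq, (h1 z hz).1, (h1 z hz).2, map_neg, neg_sq]
    have h5 := hpt g hgm hgd hgs (M * I) (by positivity) (le_trans ?_ hQ)
    · rwa [hgD _ hzD, hnsq] at h5
    · refine lintegral_mono fun v => ENNReal.ofReal_le_ofReal ?_
      rw [hg]
      simp only [hnsq]
      exact mul_le_mul_of_nonneg_left (add_le_add (hlk _) (hlk _)) (by positivity)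
  have hsum : ‖F₁ (sliceCoord p)‖ ^ 2 + ‖F₂ (sliceCoord p)‖ ^ 2 ≤ 4 * (K * (M * I)) := by
    rw [← sum_sq_quaternionCoord, ← sum_sq_quaternionCoord, ← Finset.sum_add_distrib]
    refine (Finset.sum_le_sum fun k _ => hcomp k).trans ?_
    simp
  have hfp : ‖f p‖ ≤ ‖F₁ (sliceCoord p)‖ + ‖F₂ (sliceCoord p)‖ := by
    rw [h3.eq_sliceValue h1 hDsymm hpc, sliceValue, Set.indicator_of_mem hzD,
      Set.indicator_of_mem hzD]
    refine (norm_add_le _ _).trans (add_le_add le_rfl ?_)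
    rw [norm_mul]
    exact mul_le_of_le_one_left (norm_nonneg _) (norm_sliceUnit_le _)
  have hsq := mul_self_le_mul_self (norm_nonneg _) hfp
  nlinarith [sq_nonneg (‖F₁ (sliceCoord p)‖ - ‖F₂ (sliceCoord p)‖)]

end Main

theorem theorem7p1 (D : Set ℂ) (hD : IsOpen D) (hDsymm : IsSymmetricSet D)
    (p c : ℍ) (r : ℝ) (hr : 0 < r) (hp : p ∈ ball c r)
    (hS : closedBall c r ⊆ circularization D) :
    ∃ μ : VectorMeasure (sphere c r) ℍ,
      VectorMeasure.AbsolutelyContinuous μ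
        (sphereSurfaceMeasure c r hr).toENNRealVectorMeasure ∧
      ∀ f : ℍ → ℍ, IsSliceRegular D f →
        VectorMeasure.Integrable μ (fun q : sphere c r => f q) ∧
        f p = ∫ᵛ q, f q ∂[leftMeasurePairing; μ] := by
  obtain ⟨C, hC⟩ := exists_sq_norm_le_integral_sphere hD hDsymm hr hp hS
  let ι : sliceRegularSubmodule D →ₗ[ℝ] (sphere c r → ℍ) :=
    { toFun := fun f q => f.1 q, map_add' := fun _ _ => rfl, map_smul' := fun _ _ => rfl }
  let e : sliceRegularSubmodule D →ₗ[ℝ] ℍ :=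
    { toFun := fun f => f.1 p, map_add' := fun _ _ => rfl, map_smul' := fun _ _ => rfl }
  obtain ⟨h, hh, hrep⟩ := exists_density_of_bounded (sphereSurfaceMeasure c r hr) ι
    (fun f => IsSliceRegular.memLp hD hDsymm hr hS f.2) e
    -- Right multiplication by a constant commutes with left multiplications, so it preserves
    -- regularity.
    (fun f l => ⟨⟨fun q => (ContinuousLinearMap.mul ℝ ℍ).flip l (f.1 q),
      IsSliceRegular.clm_comp f.2 _ fun x y => mul_assoc x y l⟩, fun _ => rfl, rfl⟩)
    C fun f => hC f.1 f.2
  have hi : Integrable h (sphereSurfaceMeasure c r hr) := hh.integrable one_le_two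
  refine ⟨(sphereSurfaceMeasure c r hr).withDensityᵥ h, withDensityᵥ_absolutelyContinuous' _ h hi,
    fun f hf => ?_⟩
  have hint : VectorMeasure.Integrable ((sphereSurfaceMeasure c r hr).withDensityᵥ h)
      (fun q : sphere c r => f q) := by
    obtain ⟨hm, M, hM⟩ := IsSliceRegular.measurable_and_bounded_on_sphere hD hDsymm hS hf
    -- The variation has total mass ∫|h| < ∞, so bounded measurable functions are integrable.
    have : IsFiniteMeasure ((sphereSurfaceMeasure c r hr).withDensityᵥ h).variation := by
      rw [Measure.variation_withDensityᵥ hi]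
      exact isFiniteMeasure_withDensity hi.2.ne
    exact Integrable.of_bound hm.aestronglyMeasurable M (Filter.Eventually.of_forall hM)
  refine ⟨hint, ?_⟩
  rw [integral_withDensityᵥ _ h hi leftMeasurePairing hint]
  exact hrep ⟨f, hf⟩
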